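/- Let $(\Omega,\mathcal F,(\mathcal F_t)_{t=0,\dots,T},P)$ be a filtered probability space, $T\in\mathbb N$, such that $\mathcal F_0$ contains all $P$-null sets. Let $\Theta$ be a non-empty closed subset of a separable metric space and let $d\ge 1$. For each $\theta\in\Theta$ let $S^\theta=(S^\theta_t)_{t=0,\dots,T}$ be an $\mathbb R^d$-valued adapted process with $S^\theta_0=(1,\dots,1)$ a.s. Suppose that whenever $\theta_n\to\theta$ in $\Theta$ there is a subsequence $(\theta_{n_k})$ such that $S^{\theta_{n_k}}_t\to S^\theta_t$ a.s. for each $0\le t\le T$. A strategy is a process $H=(H_1,\dots,H_T)$ with values in $\mathbb R^d$ and $H_t$ being $\mathcal F_{t-1}$-measurable; put $H\cdot S^\theta_T=\sum_{t=1}^T\langle H_t,S^\theta_t-S^\theta_{t-1}\rangle$. The condition $NRA$ (no robust arbitrage) says that for every strategy $H$, if $H\cdot S^\theta_T\ge 0$ a.s. for all $\theta\in\Theta$, then $H\cdot S^\theta_T=0$ a.s. for all $\theta\in\Theta$. A contingent claim is a family $\mathbf f=(f^\theta)_{\theta\in\Theta}$ of $\mathcal F_T$-measurable real random variables with $f^\theta\ge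 0$ a.s. It is replicable if there are $x\in\mathbb R$ and a strategy $H$ (both independent of $\theta$) with $x+H\cdot S^\theta_T=f^\theta$ a.s. for all $\theta\in\Theta$. For $\mathbf Q=(Z^\theta)_{\theta\in\Theta}\in\bigoplus_{\theta\in\Theta}L^\infty(\mathcal F_T,P)$ (all but finitely many $Z^\theta$ are zero) and a family $\mathbf g=(g^\theta)_{\theta\in\Theta}$ of $\mathcal F_T$-measurable random variables such that every $Z^\theta g^\theta$ is integrable, put $\mathbf Q(\mathbf g)=\sum_{\theta}E[Z^\theta g^\theta]$; otherwise $\mathbf Q(\mathbf g)$ is not a real number. A robust pricing system is such a $\mathbf Q$ satisfying: (i) $Z^\theta\ge 0$ a.s. for all $\theta$, and $E[Z^\theta 1_A]>0$ for some $\theta\in\Theta$, $A\in\mathcal F_T$; (ii) $\mathbf Q(\mathbf 1)=1$, where $\mathbf 1$ is the family with all members equal to $1$; (iii) with $\mathbf S_t=(S^\theta_t)_{\theta\in\Theta}$, all $Z^\theta S^\theta_t$ are integrable and $\mathbf Q(1_A\mathbf S_t)=\mathbf Q(1_A\mathbf S_{t-1})$ for all $1\le t\le T$ and $A\in\mathcal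 F_{t-1}$. Let $\mathcal Q$ be the set of all robust pricing systems. **Proposition.** Let $NRA$ hold and let $\mathbf f$ be a contingent claim. The following are equivalent: (i) $\mathbf f$ is replicable; (ii) the mapping $\mathcal Q\to\mathbb R$, $\mathbf Q\mapsto\mathbf Q(\mathbf f)$, is (well defined and) constant, i.e. there is $c\in\mathbb R$ such that for every $\mathbf Q\in\mathcal Q$, $\mathbf Q(\mathbf f)$ is a real number and equals $c$. -/

import Mathlib

open MeasureTheory Filter Topology

namespace RobustMarket

noncomputable section

variable {Ω : Type*} {mΩ : MeasurableSpace Ω} {T d : ℕ} {Θ : Type*}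

/-- The state space `ℝ^d` of the risky assets and of the positions held in them. -/
abbrev Assets (d : ℕ) : Type := EuclideanSpace ℝ (Fin d)

/-- Trading strategies: predictable processes `H_1, …, H_T` with values in `ℝ^d`. The index
`t : Fin T` stands for the trading period from date `t` (`t.castSucc`) to date `t + 1` (`t.succ`),
and the position held during that period is known at date `t`. -/
def IsStrategy (ℱ : Filtration (Fin (T + 1)) mΩ) (H : Fin T → Ω → Assets d) : Prop :=
  ∀ t : Fin T, StronglyMeasurable[ℱ t.castSucc] (H t)

/-- The terminal gain `(H · S)_T = ∑_{t=1}^T ⟨H_t, S_t - S_{t-1}⟩` in a single model. -/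
def gain (S : Fin (T + 1) → Ω → Assets d) (H : Fin T → Ω → Assets d) (ω : Ω) : ℝ :=
  ∑ t : Fin T, inner ℝ (H t ω) (S t.succ ω - S t.castSucc ω)

/-- The continuity condition on the family of models: along every convergent sequence of
parameters there is one subsequence along which prices converge almost surely at every date. -/
def IsContinuousFamily [TopologicalSpace Θ] (P : Measure Ω)
    (S : Θ → Fin (T + 1) → Ω → Assets d) : Prop :=
  ∀ (u : ℕ → Θ) (θ : Θ), Tendsto u atTop (𝓝 θ) →
    ∃ φ : ℕ → ℕ, StrictMono φ ∧
      ∀ t, ∀ᵐ ω ∂P, Tendsto (fun k => S (u (φ k)) t ω) atTop (𝓝 (S θ t ω))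

/-- No Robust Arbitrage: a strategy whose terminal gain is a.s. nonnegative in every model has
a.s. zero terminal gain in every model. -/
def NRA (P : Measure Ω) (ℱ : Filtration (Fin (T + 1)) mΩ)
    (S : Θ → Fin (T + 1) → Ω → Assets d) : Prop :=
  ∀ H : Fin T → Ω → Assets d, IsStrategy ℱ H →
    (∀ θ, ∀ᵐ ω ∂P, 0 ≤ gain (S θ) H ω) → ∀ θ, ∀ᵐ ω ∂P, gain (S θ) H ω = 0

/-- A contingent claim: a family of a.s. nonnegative `ℱ_T`-measurable random variables, one for
each model. -/
def IsContingentClaim (P : Measure Ω) (ℱ : Filtration (Fin (T + 1)) mΩ)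
    (f : Θ → Ω → ℝ) : Prop :=
  ∀ θ, StronglyMeasurable[ℱ (Fin.last T)] (f θ) ∧ ∀ᵐ ω ∂P, 0 ≤ f θ ω

/-- A claim is replicable if one initial capital and one strategy produce it in every model. -/
def IsReplicable (P : Measure Ω) (ℱ : Filtration (Fin (T + 1)) mΩ)
    (S : Θ → Fin (T + 1) → Ω → Assets d) (f : Θ → Ω → ℝ) : Prop :=
  ∃ (x : ℝ) (H : Fin T → Ω → Assets d), IsStrategy ℱ H ∧
    ∀ θ, ∀ᵐ ω ∂P, x + gain (S θ) H ω = f θ ω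

/-- The direct sum `⨁_{θ ∈ Θ} L^∞(ℱ_T, P)`, the dual of `∏_{θ ∈ Θ} L¹(ℱ_T, P)`: families of
classes in `L^∞(ℱ_T, P)` of which all but finitely many are zero. -/
abbrev Functionals (Θ : Type*) (P : Measure Ω) (ℱ : Filtration (Fin (T + 1)) mΩ) : Type _ :=
  Θ →₀ Lp ℝ ⊤ (P.trim (ℱ.le (Fin.last T)))

variable {P : Measure Ω} {ℱ : Filtration (Fin (T + 1)) mΩ}
  {E : Type*} [NormedAddCommGroup E] [NormedSpace ℝ E]

/-- The functional `Q = (Z^θ)` has a finite value at `g`: every `Z^θ g^θ` is integrable. This is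
automatic if every `g^θ` is integrable. -/
def Functionals.Defined (Q : Functionals Θ P ℱ) (g : Θ → Ω → E) : Prop :=
  ∀ θ, Integrable (fun ω => Q θ ω • g θ ω) P

/-- The value `Q(g) = ∑_θ E[Z^θ g^θ]`; for `ℝ^d`-valued `g` it is taken coordinatewise. -/
def Functionals.value (Q : Functionals Θ P ℱ) (g : Θ → Ω → E) : E :=
  ∑ θ ∈ Q.support, ∫ ω, Q θ ω • g θ ω ∂P

/-- Robust pricing systems for `S`. -/
structure IsRobustPricingSystem (S : Θ → Fin (T + 1) → Ω → Assets d)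
    (Q : Functionals Θ P ℱ) : Prop where
  nonneg : ∀ θ, ∀ᵐ ω ∂P, 0 ≤ Q θ ω
  pos : ∃ (θ : Θ) (A : Set Ω), MeasurableSet[ℱ (Fin.last T)] A ∧ 0 < ∫ ω in A, Q θ ω ∂P
  normalized : Q.value (fun _ _ => (1 : ℝ)) = 1
  defined : ∀ t : Fin (T + 1), Q.Defined (fun θ => S θ t)
  martingale : ∀ (t : Fin T) (A : Set Ω), MeasurableSet[ℱ t.castSucc] A →
    Q.value (fun θ => A.indicator (S θ t.succ)) = Q.value (fun θ => A.indicator (S θ t.castSucc))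

/-- The set `𝒬^θ` of robust pricing systems for the model `θ`. -/
def pricingSystemsAt (P : Measure Ω) (ℱ : Filtration (Fin (T + 1)) mΩ)
    (S : Θ → Fin (T + 1) → Ω → Assets d) (θ : Θ) : Set (Functionals Θ P ℱ) :=
  {Q | IsRobustPricingSystem S Q ∧ Q θ ≠ 0}

/-- The set `𝒬 = ⋃_θ 𝒬^θ` of all robust pricing systems. -/
def pricingSystems (P : Measure Ω) (ℱ : Filtration (Fin (T + 1)) mΩ)
    (S : Θ → Fin (T + 1) → Ω → Assets d) : Set (Functionals Θ P ℱ) :=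
  ⋃ θ, pricingSystemsAt P ℱ S θ

/-- The map `𝒬 → ℝ, Q ↦ Q(f)` is well defined (finite) and constant. -/
def HasConstantPrice (P : Measure Ω) (ℱ : Filtration (Fin (T + 1)) mΩ)
    (S : Θ → Fin (T + 1) → Ω → Assets d) (f : Θ → Ω → ℝ) : Prop :=
  ∃ c : ℝ, ∀ Q ∈ pricingSystems P ℱ S, Q.Defined f ∧ Q.value f = c

end

end RobustMarket

namespace RobustMarket

noncomputable section

/-! ### Measurable selection of convergent subsequences -/

section Selection

variable {Ω E : Type*} [NormedAddCommGroup E]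

/-! From a replication to a constant price: the price of the claim is computed by undoing the
trading periods from the last to the first. A pricing system only makes the sum over the models of
the weighted increments `Q θ • (S θ t.succ - S θ t.castSucc)` a martingale difference, so one
position common to all models has price zero in total when it is bounded. Unbounded positions are
localised to `{‖H t‖ ≤ n}`. Since the claim is nonnegative, a bound on the total price bounds the
price in each model, which yields integrability and passage to the limit (`sum_setIntegral_gain`).

From a constant price to a replication: let `D` be a countable dense set of parameters. By
continuity of the family, NRA for all models gives NRA for the models in `D`. Under NRA the cone of
families superhedged at zero cost is closed under a.s. convergence in each model
(`isModuleCone_superhedged`). A countable product of `L¹` spaces is metrizable and each continuous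
functional on it involves finitely many coordinates. Hence Hahn–Banach separates a family outside
the cone by finitely many bounded densities, and these normalise to a pricing system that gives the
family a positive price (`exists_isRobustPricingSystem_value_pos`). As `f - c` and `c - f` have
price zero under every pricing system, both are superhedged at zero cost, and NRA turns the two
inequalities into equalities on `D`. For any further `θ`, the same argument on `D ∪ {θ}` gives a
second strategy; the difference of the two has zero gain on `D`, hence nonnegative gain everywhere,
hence zero gain at `θ` by NRA.

Closedness is proved one period at a time (`stepCone_closed_aux`). Bounded positions have measurable
convergent random subsequences. Positions that escape to infinity have a limit direction that NRA
makes reversible, so it can be subtracted to eliminate a coordinate. -/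

theorem exists_frequently_dist_lt [ProperSpace E] {q : ℕ → E} (hq : DenseRange q) {x : ℕ → E}
    {p : ℕ → Prop} {R ε : ℝ} (hε : 0 < ε) (h : ∃ᶠ n in atTop, p n ∧ ‖x n‖ ≤ R) :
    ∃ j, ∃ᶠ n in atTop, p n ∧ dist (x n) (q j) < ε := by
  obtain ⟨φ, hφ, hp⟩ := extraction_of_frequently_atTop h
  obtain ⟨a, -, ψ, hψ, ha⟩ := tendsto_subseq_of_bounded (s := Metric.closedBall (0 : E) R)
    Metric.isBounded_closedBall (x := x ∘ φ) (fun n => by simpa using (hp n).2)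
  obtain ⟨j, hj⟩ := hq.exists_dist_lt a hε
  refine ⟨j, ?_⟩
  have h1 : ∀ᶠ n in atTop, dist (x (φ (ψ n))) (q j) < ε :=
    (ha.dist tendsto_const_nhds).eventually_lt_const hj
  have h2 : Tendsto (fun n => φ (ψ n)) atTop atTop := (hφ.comp hψ).tendsto_atTop
  exact h2.frequently (h1.frequently.mono fun n hn => ⟨(hp _).1, hn⟩)

/-- The index of the first ball of radius `2⁻ᵏ` that contains infinitely many of the points
`X n ω` with `ω ∈ B n`. -/
def ballIndex (q : ℕ → E) (X : ℕ → Ω → E) (k : ℕ) (B : ℕ → Set Ω) (ω : Ω) : ℕ :=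
  sInf {j | ∃ᶠ n in atTop, ω ∈ B n ∧ dist (X n ω) (q j) < (1 / 2) ^ k}

/-- Nested families of events along which the points `X n ω` concentrate. -/
def nestedEvents (q : ℕ → E) (X : ℕ → Ω → E) : ℕ → ℕ → Set Ω
  | 0 => fun _ => Set.univ
  | k + 1 => fun n => nestedEvents q X k n ∩
      {ω | dist (X n ω) (q (ballIndex q X k (nestedEvents q X k) ω)) < (1 / 2) ^ k}

/-- The random subsequence that picks its `k`-th index among the `k`-th nested events. -/
def selectedIndex (q : ℕ → E) (X : ℕ → Ω → E) : ℕ → Ω → ℕ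
  | 0 => fun _ => 0
  | k + 1 => fun ω => sInf {n | selectedIndex q X k ω < n ∧ ω ∈ nestedEvents q X (k + 1) n}

theorem measurable_sInf_nat {m : MeasurableSpace Ω} {p : ℕ → Ω → Prop}
    (hp : ∀ j, MeasurableSet {ω | p j ω}) : Measurable fun ω => sInf {j | p j ω} := by
  classical
  have h0 : MeasurableSet {ω | ∃ j, p j ω} := by
    rw [Set.ofPred_exists]; exact MeasurableSet.iUnion hp
  refine measurable_to_countable' fun k => ?_
  -- The second event is there because `sInf ∅ = 0` in `ℕ`.
  have : (fun ω => sInf {j | p j ω}) ⁻¹' {k} =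
      ({ω | p k ω} ∩ ⋂ j < k, {ω | p j ω}ᶜ) ∪ ({ω | ∃ j, p j ω}ᶜ ∩ {_ω | k = 0}) := by
    ext ω
    simp only [Set.mem_preimage, Set.mem_singleton_iff, Set.mem_union, Set.mem_inter_iff,
      Set.mem_ofPred_eq, Set.mem_iInter, Set.mem_compl_iff]
    constructor
    · rintro rfl
      by_cases h : ∃ j, p j ω
      · exact Or.inl ⟨Nat.sInf_mem (s := {j | p j ω}) h, fun j hj => Nat.notMem_of_lt_sInf hj⟩
      · refine Or.inr ⟨h, ?_⟩
        rw [Nat.sInf_eq_zero]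
        right; ext j; simp only [Set.mem_ofPred_eq, Set.mem_empty_iff_false, iff_false]
        exact fun hj => h ⟨j, hj⟩
    · rintro (⟨h1, h2⟩ | ⟨h1, rfl⟩)
      · refine le_antisymm (Nat.sInf_le h1) ?_
        by_contra! hlt
        exact h2 _ hlt (Nat.sInf_mem (s := {j | p j ω}) ⟨k, h1⟩)
      · rw [Nat.sInf_eq_zero]
        right; ext j; simp only [Set.mem_ofPred_eq, Set.mem_empty_iff_false, iff_false]
        exact fun hj => h1 ⟨j, hj⟩
  rw [this]
  refine MeasurableSet.union ?_ ?_
  · exact (hp k).inter (MeasurableSet.iInter fun j => MeasurableSet.iInter fun _ => (hp j).compl)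
  · exact h0.compl.inter (MeasurableSet.const _)

theorem measurableSet_frequently {m : MeasurableSpace Ω} {p : ℕ → Ω → Prop}
    (hp : ∀ j, MeasurableSet {ω | p j ω}) : MeasurableSet {ω | ∃ᶠ n in atTop, p n ω} := by
  have : {ω | ∃ᶠ n in atTop, p n ω} = ⋂ N, ⋃ n ≥ N, {ω | p n ω} := by
    ext ω; simp [frequently_atTop]
  rw [this]
  exact MeasurableSet.iInter fun N => MeasurableSet.iUnion fun n => MeasurableSet.iUnion fun _ => hp n

variable [MeasurableSpace E] [BorelSpace E] [SecondCountableTopology E]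

theorem measurableSet_nestedEvents {m : MeasurableSpace Ω} (q : ℕ → E) {X : ℕ → Ω → E}
    (hX : ∀ n, Measurable (X n)) (k n : ℕ) : MeasurableSet (nestedEvents q X k n) := by
  induction k generalizing n with
  | zero => exact MeasurableSet.univ
  | succ k ih =>
    refine (ih n).inter ?_
    have hj : Measurable (ballIndex q X k (nestedEvents q X k)) := by
      refine measurable_sInf_nat fun j => measurableSet_frequently fun n => ?_
      exact (ih n).inter (measurableSet_lt ((hX n).dist measurable_const) measurable_const)
    have hq : Measurable fun ω => q (ballIndex q X k (nestedEvents q X k) ω) :=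
      (measurable_from_nat (f := q)).comp hj
    exact measurableSet_lt ((hX n).dist hq) measurable_const

theorem measurable_selectedIndex {m : MeasurableSpace Ω} (q : ℕ → E) {X : ℕ → Ω → E}
    (hX : ∀ n, Measurable (X n)) (k : ℕ) : Measurable (selectedIndex q X k) := by
  induction k with
  | zero => exact measurable_const
  | succ k ih =>
    refine measurable_sInf_nat fun n => ?_
    exact (measurableSet_lt ih measurable_const).inter (measurableSet_nestedEvents q hX (k + 1) n)

/-- A sequence of random vectors that does not escape to infinity has a measurable random
subsequence that converges at every point. -/
theorem exists_measurable_subseq [ProperSpace E] {m : MeasurableSpace Ω} {X : ℕ → Ω → E}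
    (hX : ∀ n, Measurable (X n)) (hb : ∀ ω, ∃ R : ℝ, ∃ᶠ n in atTop, ‖X n ω‖ ≤ R) :
    ∃ σ : ℕ → Ω → ℕ, (∀ k, Measurable (σ k)) ∧ (∀ ω, StrictMono fun k => σ k ω) ∧
      ∃ x : Ω → E, Measurable x ∧ ∀ ω, Tendsto (fun k => X (σ k ω) ω) atTop (𝓝 (x ω)) := by
  set q := TopologicalSpace.denseSeq E
  have hq : DenseRange q := TopologicalSpace.denseRange_denseSeq E
  have key : ∀ ω k, ∃ R : ℝ, ∃ᶠ n in atTop, ω ∈ nestedEvents q X k n ∧ ‖X n ω‖ ≤ R := by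
    intro ω k
    induction k with
    | zero => obtain ⟨R, hR⟩ := hb ω; exact ⟨R, hR.mono fun n hn => ⟨Set.mem_univ _, hn⟩⟩
    | succ k ih =>
      obtain ⟨R, hR⟩ := ih
      -- Compactness of bounded balls makes the set under `sInf` nonempty, so `ballIndex` is a
      -- genuine minimum and not the default value.
      have h : ∃ᶠ n in atTop, ω ∈ nestedEvents q X k n ∧
          dist (X n ω) (q (ballIndex q X k (nestedEvents q X k) ω)) < (1 / 2) ^ k :=
        Nat.sInf_mem (s := {j | ∃ᶠ n in atTop, ω ∈ nestedEvents q X k n ∧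
          dist (X n ω) (q j) < (1 / 2) ^ k}) (exists_frequently_dist_lt hq (by positivity) hR)
      refine ⟨‖q (ballIndex q X k (nestedEvents q X k) ω)‖ + (1 / 2) ^ k, ?_⟩
      refine Frequently.mono h fun n hn => ⟨⟨hn.1, hn.2⟩, ?_⟩
      have h2 := hn.2.le
      rw [dist_eq_norm] at h2
      have := norm_le_norm_add_norm_sub' (X n ω) (q (ballIndex q X k (nestedEvents q X k) ω))
      linarith
  have hsel : ∀ ω k, selectedIndex q X k ω < selectedIndex q X (k + 1) ω ∧
      ω ∈ nestedEvents q X (k + 1) (selectedIndex q X (k + 1) ω) := by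
    intro ω k
    obtain ⟨R, hR⟩ := key ω (k + 1)
    obtain ⟨n, hn, hn'⟩ := frequently_atTop.1 hR (selectedIndex q X k ω + 1)
    exact Nat.sInf_mem (s := {n | selectedIndex q X k ω < n ∧ ω ∈ nestedEvents q X (k + 1) n})
      ⟨n, by omega, hn'.1⟩
  have hmono : ∀ ω n k l, k ≤ l → ω ∈ nestedEvents q X l n → ω ∈ nestedEvents q X k n := by
    intro ω n k l hkl h
    induction l, hkl using Nat.le_induction with
    | base => exact h
    | succ l _ ih => exact ih h.1
  have hlim : ∀ ω, ∃ x, Tendsto (fun k => X (selectedIndex q X k ω) ω) atTop (𝓝 x) := by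
    intro ω
    refine cauchySeq_tendsto_of_complete (Metric.cauchySeq_iff'.2 fun ε hε => ?_)
    obtain ⟨k, hk⟩ := exists_pow_lt_of_lt_one (half_pos hε) (by norm_num : (1 / 2 : ℝ) < 1)
    -- All selected points from `k + 1` on lie in one ball of radius `2⁻ᵏ`, hence within `2 · 2⁻ᵏ <
    -- ε` of each other.
    have hnear : ∀ l ≥ k + 1, dist (X (selectedIndex q X l ω) ω)
        (q (ballIndex q X k (nestedEvents q X k) ω)) < (1 / 2) ^ k := by
      intro l hl
      obtain ⟨l, rfl⟩ : ∃ l', l = l' + 1 := ⟨l - 1, by omega⟩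
      exact (hmono ω _ (k + 1) (l + 1) hl (hsel ω l).2).2
    refine ⟨k + 1, fun l hl => ?_⟩
    have h1 := hnear l hl
    have h2 := hnear (k + 1) le_rfl
    have := dist_triangle_right (X (selectedIndex q X l ω) ω)
      (X (selectedIndex q X (k + 1) ω) ω) (q (ballIndex q X k (nestedEvents q X k) ω))
    linarith
  choose x hx using hlim
  have hσ := measurable_selectedIndex q hX
  refine ⟨selectedIndex q X, hσ, fun ω => strictMono_nat_of_lt_succ fun k => (hsel ω k).1, x,
    ?_, hx⟩
  refine measurable_of_tendsto_metrizable (f := fun k ω => X (selectedIndex q X k ω) ω)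
    (fun k => ?_) (tendsto_pi_nhds.2 hx)
  have : Measurable fun p : ℕ × Ω => X p.1 p.2 := measurable_from_prod_countable_right hX
  exact this.comp ((hσ k).prodMk measurable_id)

end Selection

/-! ### Closed convex cones of families of payoffs that are stable under random scaling -/

section ModuleCone

variable {Ω ι : Type*} {mΩ : MeasurableSpace Ω} {P : Measure Ω} {d : ℕ}

/-- A set of families of payoffs that is a convex cone over the nonnegative `m`-measurable
functions and closed under sequential almost sure convergence in every model. -/
structure IsModuleCone (P : Measure Ω) (m : MeasurableSpace Ω) (C : Set (ι → Ω → ℝ)) : Prop where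
  zero_mem : (fun _ _ => 0) ∈ C
  add_mem : ∀ {g g' : ι → Ω → ℝ}, g ∈ C → g' ∈ C → (fun i ω => g i ω + g' i ω) ∈ C
  mul_mem : ∀ {φ : Ω → ℝ} {g : ι → Ω → ℝ}, Measurable[m] φ → (∀ ω, 0 ≤ φ ω) → g ∈ C →
    (fun i ω => φ ω * g i ω) ∈ C
  closed : ∀ (u : ℕ → ι → Ω → ℝ) (g : ι → Ω → ℝ), (∀ n, u n ∈ C) →
    (∀ i, ∀ᵐ ω ∂P, Tendsto (fun n => u n i ω) atTop (𝓝 (g i ω))) → g ∈ C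

namespace IsModuleCone

variable {m : MeasurableSpace Ω} {C : Set (ι → Ω → ℝ)}

theorem mono (hC : IsModuleCone P m C) {m' : MeasurableSpace Ω} (h : m' ≤ m) :
    IsModuleCone P m' C :=
  ⟨hC.zero_mem, hC.add_mem, fun hφ => hC.mul_mem (hφ.mono h le_rfl), hC.closed⟩

theorem congr_mem (hC : IsModuleCone P m C) {g g' : ι → Ω → ℝ} (hg : g ∈ C)
    (h : ∀ i, ∀ᵐ ω ∂P, g i ω = g' i ω) : g' ∈ C :=
  hC.closed (fun _ => g) g' (fun _ => hg) fun i => by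
    filter_upwards [h i] with ω hω
    rw [hω]
    exact tendsto_const_nhds

theorem indicator_mem (hC : IsModuleCone P m C) {g : ι → Ω → ℝ} (hg : g ∈ C) {B : Set Ω}
    (hB : MeasurableSet[m] B) : (fun i ω => B.indicator (g i) ω) ∈ C := by
  classical
  have h := hC.mul_mem (φ := B.indicator fun _ => 1) (measurable_const.indicator hB)
    (fun ω => Set.indicator_nonneg (fun _ _ => zero_le_one) ω) hg
  convert h using 3 with i ω
  by_cases hω : ω ∈ B <;> simp [hω]

theorem sum_mem (hC : IsModuleCone P m C) {κ : Type*} (s : Finset κ) {g : κ → ι → Ω → ℝ}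
    (hg : ∀ k ∈ s, g k ∈ C) : (fun i ω => ∑ k ∈ s, g k i ω) ∈ C := by
  classical
  induction s using Finset.induction_on with
  | empty => simpa using hC.zero_mem
  | insert a s ha ih =>
    simp only [Finset.sum_insert ha]
    exact hC.add_mem (hg a (by simp)) (ih fun k hk => hg k (by simp [hk]))

/-- Cut along the events `σ = n`: the partial sums lie in the cone and are eventually constant at
each `ω`. -/
theorem random_index_mem (hC : IsModuleCone P m C) {u : ℕ → ι → Ω → ℝ} (hu : ∀ n, u n ∈ C)
    {σ : Ω → ℕ} (hσ : Measurable[m] σ) : (fun i ω => u (σ ω) i ω) ∈ C := by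
  classical
  refine hC.closed (fun N i ω => ∑ n ∈ Finset.range N, (σ ⁻¹' {n}).indicator (u n i) ω) _
    (fun N => hC.sum_mem _ fun n _ => hC.indicator_mem (hu n) (hσ (measurableSet_singleton n)))
    fun i => ae_of_all _ fun ω => ?_
  refine tendsto_const_nhds.congr' ?_
  filter_upwards [eventually_gt_atTop (σ ω)] with N hN
  rw [Finset.sum_eq_single (σ ω)]
  · simp
  · intro n _ hn
    simp [Ne.symm hn]
  · intro h
    simp [hN] at h

end IsModuleCone

/-- The families that are brought into `C` by subtracting the gain of a position `h` held over one
period with price increments `D`. -/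
def stepCone (m : MeasurableSpace Ω) (D : ι → Ω → Assets d) (C : Set (ι → Ω → ℝ)) :
    Set (ι → Ω → ℝ) :=
  {g | ∃ h : Ω → Assets d, Measurable[m] h ∧ (fun i ω => g i ω - inner ℝ (h ω) (D i ω)) ∈ C}

/-! ### Adding one trading period to a closed cone. -/

section StepCone

variable {m : MeasurableSpace Ω} {C : Set (ι → Ω → ℝ)} {D : ι → Ω → Assets d}

theorem stepCone_add_mem (hC : IsModuleCone P m C) {g g' : ι → Ω → ℝ} (hg : g ∈ stepCone m D C)
    (hg' : g' ∈ stepCone m D C) : (fun i ω => g i ω + g' i ω) ∈ stepCone m D C := by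
  obtain ⟨h, hh, hc⟩ := hg
  obtain ⟨h', hh', hc'⟩ := hg'
  refine ⟨fun ω => h ω + h' ω, hh.add hh', ?_⟩
  convert hC.add_mem hc hc' using 3
  rw [inner_add_left]; ring

theorem stepCone_mul_mem (hC : IsModuleCone P m C) {φ : Ω → ℝ} {g : ι → Ω → ℝ}
    (hφ : Measurable[m] φ) (hφ0 : ∀ ω, 0 ≤ φ ω) (hg : g ∈ stepCone m D C) :
    (fun i ω => φ ω * g i ω) ∈ stepCone m D C := by
  obtain ⟨h, hh, hc⟩ := hg
  refine ⟨fun ω => φ ω • h ω, hφ.smul hh, ?_⟩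
  convert hC.mul_mem hφ hφ0 hc using 3
  rw [real_inner_smul_left]; ring

theorem stepCone_indicator_mem (hC : IsModuleCone P m C) {g : ι → Ω → ℝ}
    (hg : g ∈ stepCone m D C) {B : Set Ω} (hB : MeasurableSet[m] B) :
    (fun i ω => B.indicator (g i) ω) ∈ stepCone m D C := by
  classical
  have h := stepCone_mul_mem hC (φ := B.indicator fun _ => 1) (measurable_const.indicator hB)
    (fun ω => Set.indicator_nonneg (fun _ _ => zero_le_one) ω) hg
  convert h using 3 with i ω
  by_cases hω : ω ∈ B <;> simp [hω]

theorem stepCone_zero_mem (hC : IsModuleCone P m C) : (fun _ _ => 0) ∈ stepCone m D C :=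
  ⟨fun _ => 0, measurable_const, by simpa using hC.zero_mem⟩

/-- The events may overlap, so each new one is glued to the part of the earlier union outside it. -/
theorem stepCone_biUnion_mem (hC : IsModuleCone P m C) {κ : Type*} (s : Finset κ) {B : κ → Set Ω}
    (hB : ∀ k, MeasurableSet[m] (B k)) {g : ι → Ω → ℝ}
    (hg : ∀ k ∈ s, (fun i ω => (B k).indicator (g i) ω) ∈ stepCone m D C) :
    (fun i ω => (⋃ k ∈ s, B k).indicator (g i) ω) ∈ stepCone m D C := by
  classical
  induction s using Finset.induction_on with
  | empty => simpa using stepCone_zero_mem hC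
  | insert a s ha ih =>
    have h1 := hg a (by simp)
    have h2 := stepCone_indicator_mem hC (ih fun k hk => hg k (by simp [hk])) (hB a).compl
    convert stepCone_add_mem hC h1 h2 using 3 with i ω
    rw [Finset.set_biUnion_insert]
    by_cases hω : ω ∈ B a
    · simp [hω]
    · rw [Set.indicator_of_notMem hω, Set.indicator_of_mem (s := (B a)ᶜ) hω, zero_add]
      by_cases hω' : ω ∈ ⋃ k ∈ s, B k
      · rw [Set.indicator_of_mem hω', Set.indicator_of_mem (Set.mem_union_right _ hω')]
      · rw [Set.indicator_of_notMem hω', Set.indicator_of_notMem]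
        rintro (h | h)
        exacts [hω h, hω' h]


/-- A reversible position may be scaled by a factor of any sign: split the factor into positive and
negative parts. -/
theorem mul_inner_mem (hC : IsModuleCone P m C) {h : Ω → Assets d}
    (h1 : (fun i ω => -inner ℝ (h ω) (D i ω)) ∈ C) (h2 : (fun i ω => inner ℝ (h ω) (D i ω)) ∈ C)
    {φ : Ω → ℝ} (hφ : Measurable[m] φ) : (fun i ω => φ ω * inner ℝ (h ω) (D i ω)) ∈ C := by
  have e1 := hC.mul_mem (φ := fun ω => max (φ ω) 0) (hφ.max measurable_const)
    (fun ω => le_max_right _ _) h2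
  have e2 := hC.mul_mem (φ := fun ω => max (-φ ω) 0) (hφ.neg.max measurable_const)
    (fun ω => le_max_right _ _) h1
  convert hC.add_mem e1 e2 using 3 with i ω
  rcases le_total (φ ω) 0 with h | h
  · rw [max_eq_right h, max_eq_left (by linarith)]; ring
  · rw [max_eq_left h, max_eq_right (by linarith)]; ring

/-- The part of the space on which the positions do not escape to infinity. -/
def tameSet (H : ℕ → Ω → Assets d) : Set Ω := {ω | ∃ R : ℕ, ∃ᶠ n in atTop, ‖H n ω‖ ≤ R}

theorem measurableSet_tameSet {H : ℕ → Ω → Assets d} (hH : ∀ n, Measurable[m] (H n)) :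
    MeasurableSet[m] (tameSet H) := by
  unfold tameSet
  rw [Set.ofPred_exists]
  exact MeasurableSet.iUnion fun R => measurableSet_frequently fun n =>
    measurableSet_le (hH n).norm measurable_const

theorem tendsto_norm_of_notMem_tameSet {H : ℕ → Ω → Assets d} {ω : Ω} (hω : ω ∉ tameSet H) :
    Tendsto (fun n => ‖H n ω‖) atTop atTop := by
  refine tendsto_atTop.2 fun b => ?_
  obtain ⟨R, hR⟩ := exists_nat_ge b
  have : ¬ ∃ᶠ n in atTop, ‖H n ω‖ ≤ R := fun h => hω ⟨R, h⟩
  filter_upwards [not_frequently.1 this] with n hn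
  linarith [not_le.1 hn]

/-- The random subsequence is chosen from the positions alone, so it serves every model at once;
along it the remainders `c n` converge as well, and their limit is in `C`. -/
theorem indicator_tameSet_mem (hC : IsModuleCone P m C) {H : ℕ → Ω → Assets d}
    {c : ℕ → ι → Ω → ℝ} {g : ι → Ω → ℝ} (hH : ∀ n, Measurable[m] (H n)) (hc : ∀ n, c n ∈ C)
    (hg : ∀ i, ∀ᵐ ω ∂P,
      Tendsto (fun n => inner ℝ (H n ω) (D i ω) + c n i ω) atTop (𝓝 (g i ω))) :
    (fun i ω => (tameSet H).indicator (g i) ω) ∈ stepCone m D C := by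
  classical
  have hA := measurableSet_tameSet hH
  obtain ⟨σ, hσ, hmono, x, hx, hlim⟩ := exists_measurable_subseq (m := m)
    (X := fun n => (tameSet H).indicator (H n)) (fun n => (hH n).indicator hA) (by
      intro ω
      by_cases hω : ω ∈ tameSet H
      · obtain ⟨R, hR⟩ := hω
        exact ⟨R, hR.mono fun n hn => (norm_indicator_le_norm_self _ _).trans hn⟩
      · exact ⟨0, Frequently.of_forall fun n => by simp [hω]⟩)
  refine ⟨x, hx, hC.closed (fun k i ω => (tameSet H).indicator (c (σ k ω) i) ω) _
    (fun k => ?_) fun i => ?_⟩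
  · exact hC.indicator_mem (hC.random_index_mem hc (hσ k)) hA
  · filter_upwards [hg i] with ω hω
    by_cases h : ω ∈ tameSet H
    · have h1 := hω.comp (hmono ω).tendsto_atTop
      have h2 := hlim ω
      simp only [h, Set.indicator_of_mem] at h2 ⊢
      have h3 := h1.sub (h2.inner (tendsto_const_nhds (x := D i ω)))
      refine h3.congr fun k => ?_
      simp
    · have h2 := hlim ω
      simp only [h, not_false_eq_true, Set.indicator_of_notMem] at h2 ⊢
      -- Off the tame set the truncated positions vanish, and so does their limit.
      rw [← tendsto_nhds_unique tendsto_const_nhds h2]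
      simp

/-- Where the positions escape to infinity, a limit of their directions is a position whose gain
and loss can both be offset. -/
theorem exists_limit_direction (hC : IsModuleCone P m C)
    (hNA : ∀ h : Ω → Assets d, Measurable[m] h → (fun i ω => -inner ℝ (h ω) (D i ω)) ∈ C →
      (fun i ω => inner ℝ (h ω) (D i ω)) ∈ C)
    {H : ℕ → Ω → Assets d}
    {c : ℕ → ι → Ω → ℝ} {g : ι → Ω → ℝ} (hH : ∀ n, Measurable[m] (H n)) (hc : ∀ n, c n ∈ C)
    (hg : ∀ i, ∀ᵐ ω ∂P,
      Tendsto (fun n => inner ℝ (H n ω) (D i ω) + c n i ω) atTop (𝓝 (g i ω))) :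
    ∃ h : Ω → Assets d, Measurable[m] h ∧ (∀ ω ∉ tameSet H, h ω ≠ 0) ∧
      (∀ j ω, (∀ n, H n ω j = 0) → h ω j = 0) ∧
      (fun i ω => -inner ℝ (h ω) (D i ω)) ∈ C ∧ (fun i ω => inner ℝ (h ω) (D i ω)) ∈ C := by
  classical
  have hA := (measurableSet_tameSet hH).compl
  set A := (tameSet H)ᶜ with hAdef
  have hbd : ∀ n ω, ‖A.indicator (fun ω => ‖H n ω‖⁻¹ • H n ω) ω‖ ≤ 1 := by
    intro n ω
    refine (norm_indicator_le_norm_self _ _).trans ?_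
    rw [norm_smul, norm_inv, norm_norm]
    exact inv_mul_le_one
  obtain ⟨σ, hσ, hmono, h, hh, hlim⟩ := exists_measurable_subseq (m := m)
    (X := fun n => A.indicator (fun ω => ‖H n ω‖⁻¹ • H n ω))
    (fun n => ((hH n).norm.inv.smul (hH n)).indicator hA)
    (fun ω => ⟨1, Frequently.of_forall fun n => hbd n ω⟩)
  -- Dividing the assumed convergence by `‖H n ω‖ → ∞` kills the limit `g`, so the normalised
  -- remainders tend to `-⟨h, D⟩`.
  have hneg : (fun i ω => -inner ℝ (h ω) (D i ω)) ∈ C := by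
    refine hC.closed (fun k i ω => A.indicator (fun ω => ‖H (σ k ω) ω‖⁻¹ * c (σ k ω) i ω) ω) _
      (fun k => ?_) fun i => ?_
    · exact hC.indicator_mem (hC.random_index_mem
        (u := fun n i ω => ‖H n ω‖⁻¹ * c n i ω)
        (fun n => hC.mul_mem (hH n).norm.inv (fun ω => by positivity) (hc n)) (hσ k)) hA
    · filter_upwards [hg i] with ω hω
      have h2 := hlim ω
      by_cases hωA : ω ∈ A
      · have h0 := tendsto_norm_of_notMem_tameSet hωA
        have h1 := (h0.inv_tendsto_atTop.mul hω).comp (hmono ω).tendsto_atTop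
        simp only [hωA, Set.indicator_of_mem] at h2 ⊢
        have h3 := h1.sub (h2.inner (tendsto_const_nhds (x := D i ω)))
        simp only [zero_mul, zero_sub] at h3
        refine h3.congr fun k => ?_
        simp only [Function.comp, Pi.inv_apply, real_inner_smul_left]
        ring
      · simp only [hωA, not_false_eq_true, Set.indicator_of_notMem] at h2 ⊢
        rw [← tendsto_nhds_unique tendsto_const_nhds h2]
        simp
  refine ⟨h, hh, fun ω hω h0 => ?_, fun j ω hj => ?_, hneg, hNA h hh hneg⟩
  · have hωA : ω ∈ A := hω
    have h1 := ((tendsto_norm_of_notMem_tameSet hω).comp (hmono ω).tendsto_atTop)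
    have h2 := (hlim ω).norm
    rw [h0, norm_zero] at h2
    -- The normalised positions eventually have norm one, so their limit cannot vanish.
    have h3 : (fun _ : ℕ => (1 : ℝ)) =ᶠ[atTop]
        fun k => ‖A.indicator (fun ω => ‖H (σ k ω) ω‖⁻¹ • H (σ k ω) ω) ω‖ := by
      filter_upwards [h1.eventually_gt_atTop 0] with k hk
      simp only [Function.comp] at hk
      rw [Set.indicator_of_mem hωA, norm_smul, norm_inv, norm_norm, inv_mul_cancel₀ hk.ne']
    have h4 := (tendsto_const_nhds (x := (1 : ℝ)) (f := (atTop : Filter ℕ))).congr' h3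
    have h5 : Tendsto (fun k => ‖A.indicator (fun ω => ‖H (σ k ω) ω‖⁻¹ • H (σ k ω) ω) ω‖)
        atTop (𝓝 0) := by
      refine h2.congr fun k => ?_
      simp only [hωA, Set.indicator_of_mem]
    exact one_ne_zero (tendsto_nhds_unique h4 h5)
  · have h1 : Tendsto (fun k => (A.indicator (fun ω => ‖H (σ k ω) ω‖⁻¹ • H (σ k ω) ω) ω) j)
        atTop (𝓝 (h ω j)) := by
      have := ((continuous_apply j).comp (PiLp.continuous_ofLp 2 _)).tendsto (h ω)
      refine (this.comp (hlim ω)).congr fun k => ?_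
      by_cases hωA : ω ∈ A <;> simp [hωA]
    refine tendsto_nhds_unique h1 (tendsto_const_nhds.congr fun k => ?_)
    by_cases hωA : ω ∈ A <;> simp [hωA, hj]

/-- Induction on the set `J` of coordinates in use. Where the positions escape, the limit direction
`h` has some `h j ≠ 0` with `j ∈ J`. Subtracting `(H n j / h j) • h` removes coordinate `j`, and
since `h` is reversible the correction is absorbed into `C`. The pieces are then glued to the tame
part. -/
theorem stepCone_closed_aux (hC : IsModuleCone P m C)
    (hNA : ∀ h : Ω → Assets d, Measurable[m] h → (fun i ω => -inner ℝ (h ω) (D i ω)) ∈ C →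
      (fun i ω => inner ℝ (h ω) (D i ω)) ∈ C) (J : Finset (Fin d)) :
    ∀ (H : ℕ → Ω → Assets d) (c : ℕ → ι → Ω → ℝ) (g : ι → Ω → ℝ), (∀ n, Measurable[m] (H n)) →
      (∀ n ω, ∀ j ∉ J, H n ω j = 0) → (∀ n, c n ∈ C) →
      (∀ i, ∀ᵐ ω ∂P,
        Tendsto (fun n => inner ℝ (H n ω) (D i ω) + c n i ω) atTop (𝓝 (g i ω))) →
      g ∈ stepCone m D C := by
  classical
  induction J using Finset.strongInduction with
  | H J ih =>
    intro H c g hH hJ hc hg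
    obtain ⟨h, hh, hne, hsupp, hneg, hpos⟩ := exists_limit_direction hC hNA hH hc hg
    have hA := measurableSet_tameSet hH
    have hcoord : ∀ {x : Ω → Assets d} (j : Fin d), Measurable[m] x →
        Measurable[m] fun ω => x ω j := fun j hx =>
      ((continuous_apply j).comp (PiLp.continuous_ofLp 2 _)).measurable.comp hx
    set B : Fin d → Set Ω := fun j => (tameSet H)ᶜ ∩ {ω | h ω j ≠ 0}
    have hB : ∀ j, MeasurableSet[m] (B j) := fun j =>
      hA.compl.inter ((hcoord j hh) (measurableSet_singleton 0).compl)
    have hstep : ∀ j ∈ J, (fun i ω => (B j).indicator (g i) ω) ∈ stepCone m D C := by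
      intro j hj
      have ha : ∀ n, Measurable[m] fun ω => H n ω j / h ω j := fun n =>
        (hcoord j (hH n)).div (hcoord j hh)
      refine ih (J.erase j) (Finset.erase_ssubset hj)
        (fun n => (B j).indicator fun ω => H n ω - (H n ω j / h ω j) • h ω)
        (fun n i ω => (B j).indicator
          (fun ω => c n i ω + (H n ω j / h ω j) * inner ℝ (h ω) (D i ω)) ω) _
        (fun n => ((hH n).sub ((ha n).smul hh)).indicator (hB j)) ?_ ?_ ?_
      · intro n ω l hl
        by_cases hω : ω ∈ B j
        · have hlj : l = j ∨ l ∉ J := by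
            by_contra! hcon
            exact hl (Finset.mem_erase.2 hcon)
          rw [Set.indicator_of_mem hω]
          simp only [PiLp.sub_apply, PiLp.smul_apply, smul_eq_mul]
          rcases hlj with rfl | hlJ
          · rw [div_mul_cancel₀ _ hω.2, sub_self]
          · rw [hJ n ω l hlJ, hsupp l ω fun n => hJ n ω l hlJ]; simp
        · simp [hω]
      · intro n
        exact hC.indicator_mem (hC.add_mem (hc n) (mul_inner_mem hC hneg hpos (ha n))) (hB j)
      · intro i
        filter_upwards [hg i] with ω hω
        by_cases hωB : ω ∈ B j
        · simp only [hωB, Set.indicator_of_mem]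
          refine hω.congr fun n => ?_
          rw [inner_sub_left, real_inner_smul_left]; ring
        · simp [hωB]
    have h1 := indicator_tameSet_mem hC hH hc hg
    have h2 := stepCone_biUnion_mem hC J hB hstep
    convert stepCone_add_mem hC h1 h2 using 3 with i ω
    by_cases hω : ω ∈ tameSet H
    · rw [Set.indicator_of_mem hω, Set.indicator_of_notMem, add_zero]
      simp [B, hω]
    · rw [Set.indicator_of_notMem hω, Set.indicator_of_mem, zero_add]
      obtain ⟨j, hj⟩ : ∃ j, h ω j ≠ 0 := by
        by_contra! hcon
        exact hne ω hω (by ext j; simpa using hcon j)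
      have hjJ : j ∈ J := by
        by_contra hcon
        exact hj (hsupp j ω fun n => hJ n ω j hcon)
      exact Set.mem_biUnion (x := j) hjJ ⟨hω, hj⟩

/-- If no one-period position yields an offsettable gain whose loss is not offsettable, then one
more trading period keeps the cone closed. -/
theorem IsModuleCone.stepCone (hC : IsModuleCone P m C)
    (hNA : ∀ h : Ω → Assets d, Measurable[m] h → (fun i ω => -inner ℝ (h ω) (D i ω)) ∈ C →
      (fun i ω => inner ℝ (h ω) (D i ω)) ∈ C) : IsModuleCone P m (stepCone m D C) where
  zero_mem := stepCone_zero_mem hC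
  add_mem := stepCone_add_mem hC
  mul_mem := stepCone_mul_mem hC
  closed u g hu hg := by
    choose H hH hc using hu
    refine stepCone_closed_aux hC hNA Finset.univ H _ g hH (by simp) hc fun i => ?_
    simpa using hg i

end StepCone

end ModuleCone

/-! ### Closedness of the cone of superhedgeable families -/

section Superhedging

variable {Ω ι : Type*} {mΩ : MeasurableSpace Ω} {P : Measure Ω} {T d : ℕ}
  {ℱ : Filtration (Fin (T + 1)) mΩ} {S : ι → Fin (T + 1) → Ω → Assets d}

theorem gain_zero (S : Fin (T + 1) → Ω → Assets d) (ω : Ω) : gain S (fun _ _ => 0) ω = 0 := by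
  simp [gain]

theorem gain_add (S : Fin (T + 1) → Ω → Assets d) (H H' : Fin T → Ω → Assets d) (ω : Ω) :
    gain S (fun t ω => H t ω + H' t ω) ω = gain S H ω + gain S H' ω := by
  simp only [gain, inner_add_left, Finset.sum_add_distrib]

theorem gain_neg (S : Fin (T + 1) → Ω → Assets d) (H : Fin T → Ω → Assets d) (ω : Ω) :
    gain S (fun t ω => -H t ω) ω = -gain S H ω := by
  simp only [gain, inner_neg_left, Finset.sum_neg_distrib]

theorem gain_update (S : Fin (T + 1) → Ω → Assets d) (H : Fin T → Ω → Assets d) (t : Fin T)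
    (h : Ω → Assets d) (ω : Ω) :
    gain S (Function.update H t h) ω =
      gain S H ω + inner ℝ (h ω - H t ω) (S t.succ ω - S t.castSucc ω) := by
  classical
  have key : ∀ s, inner ℝ (Function.update H t h s ω) (S s.succ ω - S s.castSucc ω) =
      inner ℝ (H s ω) (S s.succ ω - S s.castSucc ω) +
        if s = t then inner ℝ (h ω - H t ω) (S t.succ ω - S t.castSucc ω) else 0 := by
    intro s
    by_cases hs : s = t
    · subst hs
      simp [inner_sub_left]
    · simp [hs]
  simp only [gain, key, Finset.sum_add_distrib]
  simp

theorem IsStrategy.update {H : Fin T → Ω → Assets d} (hH : IsStrategy ℱ H) {t : Fin T}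
    {h : Ω → Assets d} (hh : StronglyMeasurable[ℱ t.castSucc] h) :
    IsStrategy ℱ (Function.update H t h) := by
  intro s
  by_cases hs : s = t
  · subst hs
    simpa using hh
  · simpa [hs] using hH s

theorem IsStrategy.neg {H : Fin T → Ω → Assets d} (hH : IsStrategy ℱ H) :
    IsStrategy ℱ fun t ω => -H t ω := fun t => (hH t).neg

theorem IsStrategy.add {H H' : Fin T → Ω → Assets d} (hH : IsStrategy ℱ H)
    (hH' : IsStrategy ℱ H') : IsStrategy ℱ fun t ω => H t ω + H' t ω := fun t =>
  (hH t).add (hH' t)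

/-- The families of payoffs that are superhedged at zero cost by a strategy which trades from date
`t` on. -/
def superhedgedFrom (P : Measure Ω) (ℱ : Filtration (Fin (T + 1)) mΩ)
    (S : ι → Fin (T + 1) → Ω → Assets d) (t : ℕ) : Set (ι → Ω → ℝ) :=
  {g | ∃ H : Fin T → Ω → Assets d, IsStrategy ℱ H ∧ (∀ s : Fin T, s.val < t → ∀ ω, H s ω = 0) ∧
    ∀ i, ∀ᵐ ω ∂P, g i ω ≤ gain (S i) H ω}

theorem isModuleCone_superhedgedFrom_last (m : MeasurableSpace Ω) :
    IsModuleCone P m (superhedgedFrom P ℱ S T) := by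
  have key : ∀ g, g ∈ superhedgedFrom P ℱ S T ↔ ∀ i, ∀ᵐ ω ∂P, g i ω ≤ 0 := by
    intro g
    constructor
    · rintro ⟨H, -, h0, hg⟩ i
      filter_upwards [hg i] with ω hω
      refine hω.trans_eq ?_
      simp [gain, h0 _ (Fin.is_lt _)]
    · intro hg
      refine ⟨fun _ _ => 0, fun t => stronglyMeasurable_const, fun _ _ _ => rfl, fun i => ?_⟩
      filter_upwards [hg i] with ω hω
      rwa [gain_zero]
  constructor
  · exact (key _).2 fun i => ae_of_all _ fun ω => le_rfl
  · intro g g' hg hg'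
    rw [key] at hg hg' ⊢
    intro i
    filter_upwards [hg i, hg' i] with ω h1 h2
    exact add_nonpos h1 h2
  · intro φ g _ hφ hg
    rw [key] at hg ⊢
    intro i
    filter_upwards [hg i] with ω h1
    exact mul_nonpos_of_nonneg_of_nonpos (hφ ω) h1
  · intro u g hu hg
    simp only [key] at hu ⊢
    intro i
    filter_upwards [hg i, ae_all_iff.2 fun n => hu n i] with ω h1 h2
    exact le_of_tendsto' h1 h2

/-- Splitting off the position of the first active period turns closedness into a backward induction
over dates. -/
theorem superhedgedFrom_eq_stepCone (t : Fin T) :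
    superhedgedFrom P ℱ S t.val = stepCone (ℱ t.castSucc)
      (fun i ω => S i t.succ ω - S i t.castSucc ω) (superhedgedFrom P ℱ S (t.val + 1)) := by
  ext g
  constructor
  · rintro ⟨H, hH, h0, hg⟩
    refine ⟨H t, (hH t).measurable, Function.update H t fun _ => 0,
      hH.update stronglyMeasurable_const, fun s hs ω => ?_, fun i => ?_⟩
    · by_cases hst : s = t
      · subst hst; simp
      · have : s.val ≠ t.val := fun h => hst (Fin.ext h)
        simpa [hst] using h0 s (by omega) ω
    · filter_upwards [hg i] with ω hω
      rw [gain_update, zero_sub, inner_neg_left]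
      linarith
  · rintro ⟨h, hh, H, hH, h0, hg⟩
    refine ⟨Function.update H t h, hH.update hh.stronglyMeasurable, fun s hs ω => ?_, fun i => ?_⟩
    · have hst : s ≠ t := fun h => by subst h; exact lt_irrefl _ hs
      simpa [hst] using h0 s (by omega) ω
    · filter_upwards [hg i] with ω hω
      rw [gain_update, h0 t (Nat.lt_succ_self _), sub_zero]
      linarith

theorem isModuleCone_superhedgedFrom (hNRA : NRA P ℱ S) (t : Fin (T + 1)) :
    IsModuleCone P (ℱ t) (superhedgedFrom P ℱ S t.val) := by
  induction t using Fin.reverseInduction with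
  | last => exact isModuleCone_superhedgedFrom_last _
  | cast t ih =>
    have ih' := ih.mono (ℱ.mono (Fin.castSucc_le_succ t))
    rw [Fin.val_castSucc, superhedgedFrom_eq_stepCone]
    -- If a later strategy `H` covers the loss of `h`, then `h` followed by `H` has nonnegative
    -- gain, hence zero gain by NRA, and `-H` reproduces the gain of `h`.
    refine ih'.stepCone fun h hh hneg => ?_
    obtain ⟨H, hH, h0, hg⟩ := hneg
    have hs := hNRA (Function.update H t h) (hH.update hh.stronglyMeasurable) fun i => by
      filter_upwards [hg i] with ω hω
      rw [gain_update, h0 t (by simp), sub_zero]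
      linarith
    refine ⟨fun t ω => -H t ω, hH.neg, fun s hs ω => by simp [h0 s hs], fun i => ?_⟩
    filter_upwards [hs i] with ω hω
    rw [gain_update, h0 t (by simp), sub_zero] at hω
    rw [gain_neg]
    linarith

/-- The families of payoffs that can be superhedged at zero cost. -/
def superhedged (P : Measure Ω) (ℱ : Filtration (Fin (T + 1)) mΩ)
    (S : ι → Fin (T + 1) → Ω → Assets d) : Set (ι → Ω → ℝ) :=
  {g | ∃ H : Fin T → Ω → Assets d, IsStrategy ℱ H ∧ ∀ i, ∀ᵐ ω ∂P, g i ω ≤ gain (S i) H ω}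

/-- Under no robust arbitrage, the cone of superhedgeable families is closed. -/
theorem isModuleCone_superhedged (hNRA : NRA P ℱ S) :
    IsModuleCone P (ℱ 0) (superhedged P ℱ S) := by
  have := isModuleCone_superhedgedFrom hNRA 0
  convert this using 1
  simp [superhedged, superhedgedFrom]

end Superhedging

/-! ### Separation in a countable product of `L¹` spaces -/

section Separation

variable {Ω ι : Type*} {m mΩ : MeasurableSpace Ω} {μ : Measure Ω}

theorem ae_tendsto_of_tsum_dist_ne_top {F : ℕ → Lp ℝ 1 μ} {G : Lp ℝ 1 μ}
    (h : ∑' n, edist (F n) G ≠ ⊤) :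
    ∀ᵐ ω ∂μ, Tendsto (fun n => F n ω) atTop (𝓝 (G ω)) := by
  have hmeas : ∀ n, AEMeasurable (fun ω => ‖F n ω - G ω‖ₑ) μ := fun n =>
    ((Lp.aestronglyMeasurable (F n)).sub (Lp.aestronglyMeasurable G)).enorm
  have h1 : ∫⁻ ω, ∑' n, ‖F n ω - G ω‖ₑ ∂μ ≠ ⊤ := by
    rw [lintegral_tsum hmeas]
    convert h using 3 with n
    rw [Lp.edist_def, eLpNorm_one_eq_lintegral_enorm]
    rfl
  have h2 := ae_lt_top' (AEMeasurable.tsum hmeas) h1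
  filter_upwards [h2] with ω hω
  have h3 := ENNReal.tendsto_atTop_zero_of_tsum_ne_top hω.ne
  rw [tendsto_iff_edist_tendsto_0]
  simpa [edist_eq_enorm_sub] using h3

/-- Diagonal choice: at stage `k` the first coordinates, those with `e i ≤ k`, are within `2⁻ᵏ`.
Each coordinate thus has summable `L¹` distances from stage `e i` on. -/
theorem exists_subseq_ae_tendsto_pi [Countable ι] {F : ℕ → ι → Lp ℝ 1 μ} {G : ι → Lp ℝ 1 μ}
    (h : Tendsto F atTop (𝓝 G)) : ∃ φ : ℕ → ℕ, StrictMono φ ∧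
      ∀ i, ∀ᵐ ω ∂μ, Tendsto (fun k => F (φ k) i ω) atTop (𝓝 (G i ω)) := by
  obtain ⟨e, he⟩ := Countable.exists_injective_nat ι
  have hpow : ∀ k : ℕ, (0 : ENNReal) < 2⁻¹ ^ k := fun k => by
    refine ENNReal.pow_pos ?_ k
    simp
  have h1 : ∀ k : ℕ, ∀ᶠ n in atTop, ∀ i ∈ {i | e i ≤ k}, edist (F n i) (G i) < 2⁻¹ ^ k := by
    intro k
    have hfin : {i | e i ≤ k}.Finite := (Set.finite_Iic k).preimage he.injOn
    rw [eventually_all_finite hfin]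
    intro i _
    exact (tendsto_iff_edist_tendsto_0.1 (tendsto_pi_nhds.1 h i)).eventually_lt_const (hpow k)
  obtain ⟨φ, hφ, hP⟩ := extraction_forall_of_eventually h1
  refine ⟨φ, hφ, fun i => ?_⟩
  have h2 : ∑' k, edist (F (φ (k + e i)) i) (G i) ≠ ⊤ := by
    refine ne_top_of_le_ne_top (b := ∑' k : ℕ, (2⁻¹ : ENNReal) ^ k) ?_
      (ENNReal.tsum_le_tsum fun k => (hP (k + e i) i (by simp)).le.trans ?_)
    · rw [ENNReal.tsum_geometric, ENNReal.one_sub_inv_two, inv_inv]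
      exact ENNReal.ofNat_ne_top
    · exact pow_le_pow_right_of_le_one' (by simp) (Nat.le_add_right _ _)
  filter_upwards [ae_tendsto_of_tsum_dist_ne_top h2] with ω hω
  exact (tendsto_add_atTop_iff_nat (f := fun k => F (φ k) i ω) (e i)).1 hω

/-- A neighbourhood of zero in the product topology restricts finitely many coordinates only. On
families vanishing there the functional is bounded on a whole subspace, hence zero. -/
theorem exists_finset_eq_sum_single [DecidableEq ι] {E : ι → Type*}
    [∀ i, NormedAddCommGroup (E i)] [∀ i, NormedSpace ℝ (E i)] (ℓ : (∀ i, E i) →L[ℝ] ℝ) :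
    ∃ s : Finset ι, ∀ F, ℓ F = ∑ i ∈ s, ℓ (Pi.single i (F i)) := by
  have h0 : ∀ᶠ F in 𝓝 (0 : ∀ i, E i), ‖ℓ F‖ < 1 :=
    (ℓ.continuous.norm.tendsto' 0 0 (by simp)).eventually_lt_const one_pos
  rw [nhds_pi, Filter.Eventually, Filter.mem_pi] at h0
  obtain ⟨I, hI, t, ht, hsub⟩ := h0
  have hvanish : ∀ F : ∀ i, E i, (∀ i ∈ I, F i = 0) → ℓ F = 0 := by
    intro F hF
    by_contra hne
    have h1 : ((ℓ F)⁻¹ • F) ∈ I.pi t := fun i hi => by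
      rw [Pi.smul_apply, hF i hi, smul_zero]
      exact mem_of_mem_nhds (ht i)
    have h2 : ‖ℓ ((ℓ F)⁻¹ • F)‖ < 1 := hsub h1
    rw [map_smul, smul_eq_mul, inv_mul_cancel₀ hne, norm_one] at h2
    exact lt_irrefl _ h2
  refine ⟨hI.toFinset, fun F => ?_⟩
  have h1 := hvanish (F - ∑ i ∈ hI.toFinset, Pi.single i (F i)) fun i hi => by
    rw [Pi.sub_apply, Finset.sum_apply, Finset.sum_eq_single i]
    · simp
    · intro j _ hj
      exact Pi.single_eq_of_ne (Ne.symm hj) _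
    · intro h
      exact absurd (hI.mem_toFinset.2 hi) h
  rw [map_sub, map_sum] at h1
  linarith

/-- A continuous linear functional on `L¹` is represented, on square integrable functions, by a
bounded density. -/
theorem exists_density_of_dual_L1 [IsFiniteMeasure μ] (ℓ : Lp ℝ 1 μ →L[ℝ] ℝ) :
    ∃ Y : Ω → ℝ, StronglyMeasurable Y ∧ (∃ M : ℝ, ∀ᵐ ω ∂μ, ‖Y ω‖ ≤ M) ∧
      ∀ u : Ω → ℝ, MemLp u 2 μ → ∀ hu : MemLp u 1 μ, ℓ (hu.toLp u) = ∫ ω, Y ω * u ω ∂μ := by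
  -- The inclusion of `L²` in `L¹`, written as the Hölder product with the constant one; it brings
  -- in Riesz representation on `L²`.
  set J : Lp ℝ 2 μ →L[ℝ] Lp ℝ 1 μ :=
    (ContinuousLinearMap.mul ℝ ℝ).holderL μ 2 2 1 (Lp.const 2 μ (1 : ℝ))
  have hJ : ∀ (u : Ω → ℝ) (hu2 : MemLp u 2 μ) (hu : MemLp u 1 μ),
      J (hu2.toLp u) = hu.toLp u := by
    intro u hu2 hu
    refine Lp.ext ?_
    have h1 := ContinuousLinearMap.coeFn_holder (r := 1) (ContinuousLinearMap.mul ℝ ℝ)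
      (Lp.const 2 μ (1 : ℝ)) (hu2.toLp u)
    filter_upwards [h1, hu2.coeFn_toLp, hu.coeFn_toLp, Lp.coeFn_const 2 μ (1 : ℝ)]
      with ω h1 h2 h3 h4
    refine h1.trans ?_
    rw [h2, h3, h4]
    simp
  set y : Lp ℝ 2 μ := (InnerProductSpace.toDual ℝ (Lp ℝ 2 μ)).symm (ℓ.comp J)
  have hy : ∀ u : Ω → ℝ, MemLp u 2 μ → ∀ hu : MemLp u 1 μ,
      ℓ (hu.toLp u) = ∫ ω, y ω * u ω ∂μ := by
    intro u hu2 hu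
    have h1 : ℓ (J (hu2.toLp u)) = inner ℝ y (hu2.toLp u) := by
      rw [InnerProductSpace.toDual_symm_apply]; rfl
    rw [← hJ u hu2 hu, h1, L2.inner_def]
    refine integral_congr_ae ?_
    filter_upwards [hu2.coeFn_toLp] with ω hω
    rw [hω]
    simp [mul_comm]
  have hyint : Integrable y μ := (Lp.memLp y).integrable (by norm_num)
  -- Testing on indicators bounds all averages of `y` by `‖ℓ‖`, hence `y` itself almost everywhere.
  have habs : ∀ A, MeasurableSet A → |∫ ω in A, y ω ∂μ| ≤ ‖ℓ‖ * μ.real A := by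
    intro A hA
    have hu : ∀ p, MemLp (A.indicator fun _ => (1 : ℝ)) p μ := fun p =>
      memLp_indicator_const p hA 1 (Or.inr (measure_ne_top _ _))
    have h1 := hy _ (hu 2) (hu 1)
    have h2 : ∫ ω, y ω * A.indicator (fun _ => (1 : ℝ)) ω ∂μ = ∫ ω in A, y ω ∂μ := by
      rw [← integral_indicator hA]
      congr 1; ext ω
      by_cases h : ω ∈ A <;> simp [h]
    rw [← h2, ← h1, ← Real.norm_eq_abs]
    refine (ℓ.le_opNorm _).trans (mul_le_mul_of_nonneg_left ?_ (norm_nonneg _))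
    rw [Lp.norm_toLp, eLpNorm_indicator_const hA one_ne_zero ENNReal.one_ne_top]
    simp [Measure.real]
  have hconst : Integrable (fun _ => ‖ℓ‖) μ := integrable_const _
  have hset : ∀ A : Set Ω, ∫ _ in A, ‖ℓ‖ ∂μ = ‖ℓ‖ * μ.real A := fun A => by
    rw [setIntegral_const, smul_eq_mul, mul_comm]
  have hup : (y : Ω → ℝ) ≤ᵐ[μ] fun _ => ‖ℓ‖ :=
    ae_le_of_forall_setIntegral_le hyint hconst fun A hA _ => by
      rw [hset]; exact (abs_le.1 (habs A hA)).2
  have hlow : (fun ω => -y ω) ≤ᵐ[μ] fun _ => ‖ℓ‖ :=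
    ae_le_of_forall_setIntegral_le hyint.neg hconst fun A hA _ => by
      rw [hset, integral_neg]; linarith [(abs_le.1 (habs A hA)).1]
  refine ⟨y, Lp.stronglyMeasurable y, ⟨‖ℓ‖, ?_⟩, hy⟩
  filter_upwards [hup, hlow] with ω h1 h2
  rw [Real.norm_eq_abs, abs_le]
  exact ⟨by linarith, h1⟩

/-- Separation of a family from a closed cone by finitely many bounded densities, after rescaling
by the weights `w`. -/
theorem exists_separating_densities [Countable ι] [IsFiniteMeasure μ]
    {C : Set (ι → Ω → ℝ)} (hC : IsModuleCone μ m C) {w : ι → Ω → ℝ} (hw : ∀ i, Measurable (w i))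
    (hw0 : ∀ i ω, 0 < w i ω) {g₀ : ι → Ω → ℝ} (hg₀ : ∀ i, Measurable (g₀ i))
    (hb₀ : ∀ i, ∃ M, ∀ ω, ‖w i ω * g₀ i ω‖ ≤ M) (hnot : g₀ ∉ C) :
    ∃ (s : Finset ι) (Y : ι → Ω → ℝ), (∀ i, StronglyMeasurable (Y i)) ∧
      (∀ i, ∃ M : ℝ, ∀ᵐ ω ∂μ, ‖Y i ω‖ ≤ M) ∧
      (∀ g ∈ C, (∀ i, Measurable (g i)) → (∀ i, ∃ M, ∀ ω, ‖w i ω * g i ω‖ ≤ M) →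
        ∑ i ∈ s, ∫ ω, Y i ω * (w i ω * g i ω) ∂μ ≤ 0) ∧
      0 < ∑ i ∈ s, ∫ ω, Y i ω * (w i ω * g₀ i ω) ∂μ := by
  classical
  -- The choice of representatives is harmless: `congr_mem` makes `C` invariant under a.e.
  -- modification in each coordinate.
  set K : Set (ι → Lp ℝ 1 μ) := {F | (fun i ω => F i ω / w i ω) ∈ C} with hK
  have hconst : ∀ {c : ℝ} {g : ι → Ω → ℝ}, 0 ≤ c → g ∈ C → (fun i ω => c * g i ω) ∈ C :=
    fun hc hg => hC.mul_mem measurable_const (fun _ => hc) hg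
  have hsmul : ∀ {c : ℝ} {F : ι → Lp ℝ 1 μ}, 0 ≤ c → F ∈ K → c • F ∈ K := by
    intro c F hc hF
    refine hC.congr_mem (hconst hc hF) fun i => ?_
    filter_upwards [Lp.coeFn_smul c (F i)] with ω hω
    rw [Pi.smul_apply, hω, Pi.smul_apply, smul_eq_mul, mul_div_assoc]
  have hadd : ∀ {F G : ι → Lp ℝ 1 μ}, F ∈ K → G ∈ K → F + G ∈ K := by
    intro F G hF hG
    refine hC.congr_mem (hC.add_mem hF hG) fun i => ?_
    filter_upwards [Lp.coeFn_add (F i) (G i)] with ω hω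
    rw [Pi.add_apply, hω, Pi.add_apply, add_div]
  have hzero : (0 : ι → Lp ℝ 1 μ) ∈ K := by
    refine hC.congr_mem hC.zero_mem fun i => ?_
    filter_upwards [Lp.coeFn_zero ℝ 1 μ] with ω hω
    rw [Pi.zero_apply, hω, Pi.zero_apply, zero_div]
  have hconv : Convex ℝ K := fun F hF G hG a b ha hb _ => hadd (hsmul ha hF) (hsmul hb hG)
  have hclosed : IsClosed K := by
    refine IsSeqClosed.isClosed fun F G hF hlim => ?_
    obtain ⟨φ, -, hφ⟩ := exists_subseq_ae_tendsto_pi hlim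
    refine hC.closed (fun k i ω => F (φ k) i ω / w i ω) _ (fun k => hF (φ k)) fun i => ?_
    filter_upwards [hφ i] with ω hω
    exact hω.div_const _
  have hmem : ∀ {g : ι → Ω → ℝ}, (∀ i, Measurable (g i)) →
      (∀ i, ∃ M, ∀ ω, ‖w i ω * g i ω‖ ≤ M) → ∀ p i, MemLp (fun ω => w i ω * g i ω) p μ := by
    intro g hg hb p i
    obtain ⟨M, hM⟩ := hb i
    exact MemLp.of_bound ((hw i).mul (hg i)).aestronglyMeasurable M (ae_of_all _ hM)
  have hmemK : ∀ {g : ι → Ω → ℝ} (hL : ∀ i, MemLp (fun ω => w i ω * g i ω) 1 μ),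
      (fun i => (hL i).toLp) ∈ K ↔ g ∈ C := by
    intro g hL
    have hae : ∀ i, ∀ᵐ ω ∂μ, (hL i).toLp _ ω / w i ω = g i ω := fun i => by
      filter_upwards [(hL i).coeFn_toLp] with ω hω
      rw [hω, mul_div_cancel_left₀ _ (hw0 i ω).ne']
    exact ⟨fun h => hC.congr_mem h hae, fun h => hC.congr_mem h fun i => (hae i).mono
      fun ω hω => hω.symm⟩
  have hL₀ := hmem hg₀ hb₀
  obtain ⟨ℓ, c, hℓ, hc⟩ := geometric_hahn_banach_closed_point hconv hclosed
    (fun h => hnot ((hmemK (hL₀ 1)).1 h))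
  have hc0 : 0 < c := by simpa using hℓ 0 hzero
  -- A functional bounded above on a cone is nonpositive on it: a positive value could be scaled up
  -- to `c`.
  have hnonpos : ∀ F ∈ K, ℓ F ≤ 0 := by
    intro F hF
    by_contra! hpos
    have := hℓ _ (hsmul (div_nonneg hc0.le hpos.le) hF)
    rw [map_smul, smul_eq_mul, div_mul_cancel₀ _ hpos.ne'] at this
    exact lt_irrefl _ this
  obtain ⟨s, hs⟩ := exists_finset_eq_sum_single (E := fun _ : ι => Lp ℝ 1 μ) ℓ
  choose Y hYm hYb hY using fun i =>
    exists_density_of_dual_L1 (ℓ.comp (ContinuousLinearMap.single ℝ (fun _ : ι => Lp ℝ 1 μ) i))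
  have hval : ∀ {g : ι → Ω → ℝ} (hL : ∀ p i, MemLp (fun ω => w i ω * g i ω) p μ),
      ℓ (fun i => (hL 1 i).toLp) = ∑ i ∈ s, ∫ ω, Y i ω * (w i ω * g i ω) ∂μ := by
    intro g hL
    rw [hs]
    refine Finset.sum_congr rfl fun i _ => ?_
    rw [← hY i _ (hL 2 i) (hL 1 i)]
    rfl
  refine ⟨s, Y, hYm, hYb, fun g hg hgm hgb => ?_, ?_⟩
  · rw [← hval (hmem hgm hgb)]
    exact hnonpos _ ((hmemK _).2 hg)
  · rw [← hval hL₀]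
    exact hc0.trans hc

end Separation

/-! ### Robust pricing systems that price a given family positively -/

section Functionals

variable {Ω ι : Type*} {mΩ : MeasurableSpace Ω} {P : Measure Ω} {T d : ℕ}
  {ℱ : Filtration (Fin (T + 1)) mΩ} {S : ι → Fin (T + 1) → Ω → Assets d}
  {E : Type*} [NormedAddCommGroup E] [NormedSpace ℝ E]

theorem Functionals.ae_eq_zero {Q : Functionals ι P ℱ} {i : ι} (hi : i ∉ Q.support) :
    ∀ᵐ ω ∂P, Q i ω = 0 := by
  rw [Finsupp.notMem_support_iff.1 hi]
  filter_upwards [ae_eq_of_ae_eq_trim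
    (Lp.coeFn_zero ℝ ⊤ (P.trim (ℱ.le (Fin.last T))))] with ω hω
  exact hω

theorem Functionals.value_eq_sum (Q : Functionals ι P ℱ) {s : Finset ι} (hs : Q.support ⊆ s)
    (g : ι → Ω → E) : Q.value g = ∑ i ∈ s, ∫ ω, Q i ω • g i ω ∂P := by
  refine Finset.sum_subset hs fun i _ hi => ?_
  refine integral_eq_zero_of_ae ?_
  filter_upwards [Functionals.ae_eq_zero hi] with ω hω
  rw [hω, zero_smul, Pi.zero_apply]

theorem Functionals.value_sub {Q : Functionals ι P ℱ} {g g' : ι → Ω → E} (hg : Q.Defined g)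
    (hg' : Q.Defined g') : Q.value (fun i ω => g i ω - g' i ω) = Q.value g - Q.value g' := by
  simp only [Functionals.value, smul_sub]
  rw [← Finset.sum_sub_distrib]
  exact Finset.sum_congr rfl fun i _ => integral_sub (hg i) (hg' i)

theorem Functionals.Defined.apply {Q : Functionals ι P ℱ} {g : ι → Ω → Assets d}
    (hg : Q.Defined g) (j : Fin d) : Q.Defined fun i ω => g i ω j := fun i =>
  (EuclideanSpace.proj (𝕜 := ℝ) j).integrable_comp (hg i)

theorem Functionals.value_apply {Q : Functionals ι P ℱ} {g : ι → Ω → Assets d}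
    (hg : Q.Defined g) (j : Fin d) : Q.value g j = Q.value fun i ω => g i ω j := by
  simp only [Functionals.value]
  rw [WithLp.ofLp_sum, Finset.sum_apply]
  refine Finset.sum_congr rfl fun i _ => ?_
  exact ((EuclideanSpace.proj (𝕜 := ℝ) j).integral_comp_comm (hg i)).symm

theorem Functionals.Defined.indicator {Q : Functionals ι P ℱ} {g : ι → Ω → E}
    (hg : Q.Defined g) {A : Set Ω} (hA : MeasurableSet A) :
    Q.Defined fun i => A.indicator (g i) := fun i => by
  refine ((hg i).indicator hA).congr (ae_of_all _ fun ω => ?_)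
  by_cases h : ω ∈ A <;> simp [h]

theorem exists_functional_ae_eq [IsFiniteMeasure P] (s : Finset ι) {z : ι → Ω → ℝ}
    (hz : ∀ i, StronglyMeasurable[ℱ (Fin.last T)] (z i))
    (hb : ∀ i, ∃ M : ℝ, ∀ᵐ ω ∂(P.trim (ℱ.le (Fin.last T))), ‖z i ω‖ ≤ M) :
    ∃ Q : Functionals ι P ℱ, Q.support ⊆ s ∧ ∀ i ∈ s, Q i =ᵐ[P] z i := by
  classical
  have hL : ∀ i, MemLp (z i) ⊤ (P.trim (ℱ.le (Fin.last T))) := fun i => by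
    obtain ⟨M, hM⟩ := hb i
    exact memLp_top_of_bound (hz i).aestronglyMeasurable M hM
  refine ⟨Finsupp.onFinset s (fun i => if i ∈ s then (hL i).toLp else 0) (fun i hi => ?_),
    Finsupp.support_onFinset_subset, fun i hi => ?_⟩
  · by_contra h
    simp [h] at hi
  · rw [Finsupp.onFinset_apply, if_pos hi]
    exact ae_eq_of_ae_eq_trim (hL i).coeFn_toLp

theorem gain_single_period (S : Fin (T + 1) → Ω → Assets d) (t : Fin T) (h : Ω → Assets d)
    (ω : Ω) : gain S (Function.update (fun _ _ => 0) t h) ω =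
      inner ℝ (h ω) (S t.succ ω - S t.castSucc ω) := by
  rw [gain_update, gain_zero, sub_zero, zero_add]

theorem inner_single_indicator (A : Set Ω) (j : Fin d) (c : ℝ) (x y : Ω → Assets d) (ω : Ω) :
    inner ℝ (A.indicator (fun _ => (EuclideanSpace.single j c : Assets d)) ω) (x ω - y ω) =
      c * (A.indicator x ω j - A.indicator y ω j) := by
  by_cases h : ω ∈ A
  · simp [h, EuclideanSpace.inner_single_left]
  · simp [h]

theorem indicator_mem_superhedged {t : Fin T} {A : Set Ω} (hA : MeasurableSet[ℱ t.castSucc] A)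
    (j : Fin d) (c : ℝ) :
    (fun i ω => c * (A.indicator (S i t.succ) ω j - A.indicator (S i t.castSucc) ω j)) ∈
      superhedged P ℱ S := by
  refine ⟨Function.update (fun _ _ => 0) t (A.indicator fun _ => EuclideanSpace.single j c),
    IsStrategy.update (fun _ => stronglyMeasurable_const)
      (stronglyMeasurable_const.indicator hA), fun i => ae_of_all _ fun ω => ?_⟩
  rw [gain_single_period, inner_single_indicator]

theorem IsModuleCone.trim {m m' : MeasurableSpace Ω} (hm : m' ≤ mΩ) {C : Set (ι → Ω → ℝ)}
    (hC : IsModuleCone P m C) : @IsModuleCone Ω ι m' (P.trim hm) m C :=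
  ⟨hC.zero_mem, hC.add_mem, hC.mul_mem,
    fun u g hu hg => hC.closed u g hu fun i => ae_of_ae_trim hm (hg i)⟩

end Functionals

/-! ### From separating densities to a pricing system. -/

section PricingSystems

variable {Ω ι : Type*} {m mΩ : MeasurableSpace Ω} {P μ : Measure Ω} {T d : ℕ}
  {ℱ : Filtration (Fin (T + 1)) mΩ} {S : ι → Fin (T + 1) → Ω → Assets d}

/-- Separating densities are nonnegative, and not all zero, if the cone contains every bounded
nonpositive family. -/
theorem separating_densities_nonneg [IsFiniteMeasure μ] {C : Set (ι → Ω → ℝ)}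
    (hneg : ∀ g : ι → Ω → ℝ, (∀ i ω, g i ω ≤ 0) → g ∈ C) {w : ι → Ω → ℝ}
    (hw : ∀ i, Measurable (w i)) (hw0 : ∀ i ω, 0 < w i ω) {s : Finset ι} {Y : ι → Ω → ℝ}
    (hYi : ∀ i, Integrable (Y i) μ)
    (hY : ∀ g ∈ C, (∀ i, Measurable (g i)) → (∀ i, ∃ M, ∀ ω, ‖w i ω * g i ω‖ ≤ M) →
      ∑ i ∈ s, ∫ ω, Y i ω * (w i ω * g i ω) ∂μ ≤ 0) :
    ∀ i ∈ s, 0 ≤ᵐ[μ] Y i := by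
  classical
  intro i hi
  refine ae_nonneg_of_forall_setIntegral_nonneg (hYi i) fun A hA _ => ?_
  -- The test family is chosen so that its weighted version is `-1_A` in model `i` and zero
  -- elsewhere.
  set g : ι → Ω → ℝ := fun k ω => if k = i then -((w i ω)⁻¹ * A.indicator (fun _ => 1) ω) else 0
    with hg
  have hwg : ∀ k ω, w k ω * g k ω = if k = i then -A.indicator (fun _ => 1) ω else 0 := by
    intro k ω
    by_cases hk : k = i
    · subst hk
      simp only [hg, if_true, mul_neg]
      rw [← mul_assoc, mul_inv_cancel₀ (hw0 k ω).ne', one_mul]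
    · simp [hg, hk]
  have h1 := hY g (hneg g fun k ω => ?_) (fun k => ?_) fun k => ⟨1, fun ω => ?_⟩
  · simp only [hwg] at h1
    rw [Finset.sum_eq_single_of_mem i hi (fun k _ hk => by simp [hk])] at h1
    simp only [if_true] at h1
    have h2 : ∀ ω, Y i ω * -A.indicator (fun _ => (1 : ℝ)) ω = -A.indicator (Y i) ω := by
      intro ω
      by_cases h : ω ∈ A <;> simp [h]
    simp only [h2] at h1
    rw [integral_neg, integral_indicator hA] at h1
    linarith
  · by_cases hk : k = i
    · simp only [hg, hk, if_true, neg_nonpos]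
      exact mul_nonneg (inv_nonneg.2 (hw0 i ω).le)
        (Set.indicator_nonneg (fun _ _ => zero_le_one) ω)
    · simp [hg, hk]
  · by_cases hk : k = i
    · simp only [hg, hk, if_true]
      exact ((hw i).inv.mul (measurable_const.indicator hA)).neg
    · simp [hg, hk]
  · rw [hwg]
    by_cases hk : k = i
    · by_cases h : ω ∈ A <;> simp [hk, h]
    · simp [hk]

/-- This makes the normalising constant positive: some `Y i` is not a.e. zero, and `w i` is strictly
positive. -/
theorem sum_integral_pos [IsFiniteMeasure μ] {s : Finset ι} {Y w v : ι → Ω → ℝ}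
    (hi : ∀ i, Integrable (fun ω => Y i ω * w i ω) μ)
    (hY : ∀ i ∈ s, 0 ≤ᵐ[μ] Y i) (hw0 : ∀ i ω, 0 < w i ω)
    (hpos : 0 < ∑ i ∈ s, ∫ ω, Y i ω * v i ω ∂μ) :
    0 < ∑ i ∈ s, ∫ ω, Y i ω * w i ω ∂μ := by
  have hnn : ∀ i ∈ s, 0 ≤ᵐ[μ] fun ω => Y i ω * w i ω := fun i his => by
    filter_upwards [hY i his] with ω hω
    exact mul_nonneg hω (hw0 i ω).le
  obtain ⟨i, his, hne⟩ := Finset.exists_ne_zero_of_sum_ne_zero hpos.ne'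
  refine Finset.sum_pos' (fun i his => integral_nonneg_of_ae (hnn i his)) ⟨i, his, ?_⟩
  refine lt_of_le_of_ne (integral_nonneg_of_ae (hnn i his)) fun h0 => hne ?_
  have h1 := (integral_eq_zero_iff_of_nonneg_ae (hnn i his) (hi i)).1 h0.symm
  refine integral_eq_zero_of_ae ?_
  filter_upwards [h1] with ω hω
  have : Y i ω = 0 := (mul_eq_zero.1 hω).resolve_right (hw0 i ω).ne'
  simp [this]

/-- Under no robust arbitrage, a family that cannot be superhedged at zero cost has a positive
price under some robust pricing system. -/
theorem exists_isRobustPricingSystem_value_pos [Countable ι] [IsProbabilityMeasure P]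
    (hS : ∀ i t, StronglyMeasurable[ℱ t] (S i t)) (hNRA : NRA P ℱ S) {g : ι → Ω → ℝ}
    (hg : ∀ i, StronglyMeasurable[ℱ (Fin.last T)] (g i)) (hnot : g ∉ superhedged P ℱ S) :
    ∃ Q : Functionals ι P ℱ, IsRobustPricingSystem S Q ∧ Q.Defined g ∧ 0 < Q.value g := by
  classical
  have hm := ℱ.le (Fin.last T)
  have hSm : ∀ i t, StronglyMeasurable[ℱ (Fin.last T)] (S i t) := fun i t =>
    (hS i t).mono (ℱ.mono (Fin.le_last t))
  set K : ι → Ω → ℝ := fun i ω => ∑ t, ‖S i t ω‖ + ‖g i ω‖ with hK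
  have hK0 : ∀ i ω, 0 ≤ K i ω := fun i ω => by positivity
  have hKS : ∀ i t ω, ‖S i t ω‖ ≤ K i ω := fun i t ω =>
    (Finset.single_le_sum (f := fun t => ‖S i t ω‖) (fun _ _ => norm_nonneg _)
      (Finset.mem_univ t)).trans (le_add_of_nonneg_right (norm_nonneg _))
  have hKg : ∀ i ω, ‖g i ω‖ ≤ K i ω := fun i ω => le_add_of_nonneg_left (by positivity)
  have hKm : ∀ i, Measurable[ℱ (Fin.last T)] (K i) := fun i =>
    (Finset.measurable_sum _ fun t _ => (hSm i t).norm.measurable).add (hg i).norm.measurable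
  -- The weight makes all prices and `g` bounded, so that bounded densities `Y i * w i` integrate
  -- them.
  set w : ι → Ω → ℝ := fun i ω => (1 + K i ω)⁻¹ with hwdef
  have hw : ∀ i, Measurable[ℱ (Fin.last T)] (w i) := fun i => ((hKm i).const_add 1).inv
  have hw0 : ∀ i ω, 0 < w i ω := fun i ω => inv_pos.2 (by linarith [hK0 i ω])
  have hwK : ∀ i ω {a b : ℝ}, 0 ≤ b → ‖a‖ ≤ b * (1 + K i ω) → ‖w i ω * a‖ ≤ b := by
    intro i ω a b _ hab
    rw [norm_mul, Real.norm_of_nonneg (hw0 i ω).le, hwdef, inv_mul_le_iff₀, mul_comm]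
    · exact hab
    · linarith [hK0 i ω]
  obtain ⟨s, Y, hYm, hYb, hYC, hYg⟩ := @exists_separating_densities Ω ι (ℱ 0) (ℱ (Fin.last T))
    (P.trim hm) _ _ _ ((isModuleCone_superhedged hNRA).trim hm) w hw hw0 g
    (fun i => (hg i).measurable)
    (fun i => ⟨1, fun ω => hwK i ω zero_le_one (by linarith [hKg i ω])⟩) hnot
  have hYu : ∀ (i : ι) (u : Ω → ℝ), Measurable[ℱ (Fin.last T)] u → (∃ M, ∀ ω, ‖u ω‖ ≤ M) →
      Integrable (fun ω => Y i ω * u ω) (P.trim hm) := by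
    rintro i u hu ⟨M', hM'⟩
    obtain ⟨M, hM⟩ := hYb i
    refine Integrable.of_bound (((hYm i).mul hu.stronglyMeasurable).aestronglyMeasurable)
      (M * M') ?_
    filter_upwards [hM] with ω hω
    rw [norm_mul]
    exact mul_le_mul hω (hM' ω) (norm_nonneg _) ((norm_nonneg _).trans hω)
  have hY0 : ∀ i ∈ s, 0 ≤ᵐ[P.trim hm] Y i := by
    refine @separating_densities_nonneg Ω ι (ℱ (Fin.last T)) (P.trim hm) _
      (superhedged P ℱ S) (fun g hg => ?_) w hw hw0 s Y (fun i => ?_) hYC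
    · exact ⟨fun _ _ => 0, fun _ => stronglyMeasurable_const, fun i => ae_of_all _ fun ω => by
        rw [gain_zero]; exact hg i ω⟩
    · simpa using hYu i (fun _ => 1) measurable_const ⟨1, by simp⟩
  have hw1 : ∀ i, ∃ M, ∀ ω, ‖w i ω‖ ≤ M := fun i => ⟨1, fun ω => by
    simpa using hwK i ω (a := 1) zero_le_one (by simpa using hK0 i ω)⟩
  have hc : 0 < ∑ i ∈ s, ∫ ω, Y i ω * w i ω ∂(P.trim hm) :=
    @sum_integral_pos Ω ι (ℱ (Fin.last T)) (P.trim hm) _ s Y w _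
      (fun i => hYu i _ (hw i) (hw1 i)) hY0 hw0 hYg
  set c := ∑ i ∈ s, ∫ ω, Y i ω * w i ω ∂(P.trim hm)
  obtain ⟨Q, hQs, hQ⟩ := exists_functional_ae_eq (P := P) (ℱ := ℱ) s
    (z := fun i ω => c⁻¹ * (Y i ω * w i ω))
    (fun i => stronglyMeasurable_const.mul ((hYm i).mul (hw i).stronglyMeasurable)) (fun i => by
      obtain ⟨M, hM⟩ := hYb i
      obtain ⟨M', hM'⟩ := hw1 i
      refine ⟨c⁻¹ * (M * M'), ?_⟩
      filter_upwards [hM] with ω hω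
      rw [norm_mul, norm_mul, Real.norm_of_nonneg (inv_nonneg.2 hc.le)]
      exact mul_le_mul_of_nonneg_left
        (mul_le_mul hω (hM' ω) (norm_nonneg _) ((norm_nonneg _).trans hω)) (inv_nonneg.2 hc.le))
  have hQ0 : ∀ i ∉ s, ∀ᵐ ω ∂P, Q i ω = 0 := fun i hi =>
    Functionals.ae_eq_zero fun h => hi (hQs h)
  have hval : ∀ h : ι → Ω → ℝ, (∀ i, Measurable[ℱ (Fin.last T)] (h i)) →
      (∀ i, ∃ M, ∀ ω, ‖w i ω * h i ω‖ ≤ M) → Q.Defined h ∧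
        Q.value h = c⁻¹ * ∑ i ∈ s, ∫ ω, Y i ω * (w i ω * h i ω) ∂(P.trim hm) := by
    intro h hh hb
    have hae : ∀ i ∈ s, (fun ω => Q i ω • h i ω) =ᵐ[P]
        fun ω => c⁻¹ * (Y i ω * (w i ω * h i ω)) := fun i hi => by
      filter_upwards [hQ i hi] with ω hω
      rw [hω, smul_eq_mul]; ring
    refine ⟨fun i => ?_, ?_⟩
    · by_cases hi : i ∈ s
      · exact (integrable_congr (hae i hi)).2
          ((integrable_of_integrable_trim hm (hYu i _ ((hw i).mul (hh i)) (hb i))).const_mul _)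
      · refine (integrable_zero Ω ℝ P).congr ?_
        filter_upwards [hQ0 i hi] with ω hω
        simp [hω]
    · rw [Functionals.value_eq_sum Q hQs, Finset.mul_sum]
      refine Finset.sum_congr rfl fun i hi => ?_
      rw [integral_congr_ae (hae i hi), integral_const_mul, integral_trim hm]
      exact (hYm i).mul ((hw i).mul (hh i)).stronglyMeasurable
  have hSj : ∀ i t (j : Fin d), Measurable[ℱ (Fin.last T)] fun ω => S i t ω j := fun i t j =>
    (EuclideanSpace.proj (𝕜 := ℝ) j).continuous.measurable.comp (hSm i t).measurable
  have hdef : ∀ t, Q.Defined fun i => S i t := by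
    intro t i
    by_cases hi : i ∈ s
    · obtain ⟨M, hM⟩ := hYb i
      refine Integrable.of_bound (C := c⁻¹ * M)
        (((Lp.stronglyMeasurable (Q i)).mono hm).smul ((hSm i t).mono hm)).aestronglyMeasurable ?_
      filter_upwards [hQ i hi, ae_of_ae_trim hm hM] with ω h1 h2
      rw [h1, norm_smul, norm_mul, norm_mul, Real.norm_of_nonneg (inv_nonneg.2 hc.le), mul_assoc,
        mul_assoc]
      refine mul_le_mul_of_nonneg_left ?_ (inv_nonneg.2 hc.le)
      have h3 := hwK i ω (a := ‖S i t ω‖) zero_le_one (by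
        rw [norm_norm]; linarith [hKS i t ω])
      rw [norm_mul, norm_norm] at h3
      exact (mul_le_mul h2 h3 (by positivity) ((norm_nonneg _).trans h2)).trans_eq (mul_one M)
    · refine (integrable_zero Ω (Assets d) P).congr ?_
      filter_upwards [hQ0 i hi] with ω hω
      simp [hω]
  have hnorm : Q.value (fun _ _ => (1 : ℝ)) = 1 := by
    rw [(hval _ (fun _ => measurable_const) fun i => by simpa using hw1 i).2]
    simpa using inv_mul_cancel₀ hc.ne'
  have hQnn : ∀ i, ∀ᵐ ω ∂P, 0 ≤ Q i ω := by
    intro i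
    by_cases hi : i ∈ s
    · filter_upwards [hQ i hi, ae_of_ae_trim hm (hY0 i hi)] with ω h1 h2
      rw [h1]
      exact mul_nonneg (inv_nonneg.2 hc.le) (mul_nonneg h2 (hw0 i ω).le)
    · filter_upwards [hQ0 i hi] with ω h1
      rw [h1]
  refine ⟨Q, ⟨hQnn, ?_, hnorm, hdef, ?_⟩, ?_⟩
  · have h1 : 0 < Q.value (fun _ _ => (1 : ℝ)) := by rw [hnorm]; exact one_pos
    obtain ⟨i, -, hi⟩ := Finset.exists_lt_of_sum_lt
      (f := fun _ => (0 : ℝ)) (by simpa [Functionals.value] using h1)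
    exact ⟨i, Set.univ, MeasurableSet.univ, by simpa using hi⟩
  · intro t A hA
    have hA' : MeasurableSet[ℱ (Fin.last T)] A := ℱ.mono (Fin.le_last _) A hA
    have hAΩ : MeasurableSet A := hm A hA'
    have hd1 := (hdef t.succ).indicator hAΩ
    have hd2 := (hdef t.castSucc).indicator hAΩ
    have hcoord : ∀ t' ω i (j : Fin d), ‖A.indicator (S i t') ω j‖ ≤ K i ω := by
      intro t' ω i j
      refine (PiLp.norm_apply_le _ j).trans ((norm_indicator_le_norm_self _ _).trans (hKS i t' ω))
    have hind : ∀ t' i (j : Fin d),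
        Measurable[ℱ (Fin.last T)] fun ω => A.indicator (S i t') ω j := fun t' i j =>
      (EuclideanSpace.proj (𝕜 := ℝ) j).continuous.measurable.comp
        ((hSm i t').measurable.indicator hA')
    ext j
    -- Holding `a` units of asset `j` on `A` for one period costs nothing; the signs `a = 1` and `a
    -- = -1` give the two inequalities of the martingale property.
    have hle : ∀ a : ℝ, ‖a‖ = 1 → a * (Q.value (fun i ω => A.indicator (S i t.succ) ω j) -
        Q.value fun i ω => A.indicator (S i t.castSucc) ω j) ≤ 0 := by
      intro a ha
      have hb : ∀ i, ∃ M, ∀ ω, ‖w i ω * (a * (A.indicator (S i t.succ) ω j -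
          A.indicator (S i t.castSucc) ω j))‖ ≤ M := fun i => ⟨2, fun ω => by
        refine hwK i ω zero_le_two ?_
        rw [norm_mul, ha, one_mul]
        refine (norm_sub_le _ _).trans ?_
        linarith [hcoord t.succ ω i j, hcoord t.castSucc ω i j]⟩
      have hmeas : ∀ i, Measurable[ℱ (Fin.last T)] fun ω => a * (A.indicator (S i t.succ) ω j -
          A.indicator (S i t.castSucc) ω j) := fun i =>
        ((hind t.succ i j).sub (hind t.castSucc i j)).const_mul a
      have h1 := hYC _ (indicator_mem_superhedged hA j a) hmeas hb
      have h2 := (hval _ hmeas hb).2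
      rw [← Functionals.value_sub (hd1.apply j) (hd2.apply j)]
      have h3 : a * Q.value (fun i ω => A.indicator (S i t.succ) ω j -
          A.indicator (S i t.castSucc) ω j) = Q.value fun i ω => a *
          (A.indicator (S i t.succ) ω j - A.indicator (S i t.castSucc) ω j) := by
        simp only [Functionals.value, Finset.mul_sum, ← integral_const_mul, smul_eq_mul]
        simp only [mul_left_comm]
      rw [h3, h2]
      exact mul_nonpos_of_nonneg_of_nonpos (inv_nonneg.2 hc.le) h1
    rw [Functionals.value_apply hd1, Functionals.value_apply hd2]
    have h1 := hle 1 (by simp)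
    have h2 := hle (-1) (by simp)
    linarith
  · have h1 := hval g (fun i => (hg i).measurable)
      (fun i => ⟨1, fun ω => hwK i ω zero_le_one (by linarith [hKg i ω])⟩)
    refine ⟨h1.1, ?_⟩
    rw [h1.2]
    exact mul_pos (inv_pos.2 hc) hYg

end PricingSystems

/-! ### Replicable claims have a constant price -/

section Replicable

variable {Ω ι : Type*} {mΩ : MeasurableSpace Ω} {P : Measure Ω} {T d : ℕ}
  {ℱ : Filtration (Fin (T + 1)) mΩ} {S : ι → Fin (T + 1) → Ω → Assets d}
  {Q : Functionals ι P ℱ}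

theorem value_indicator {E : Type*} [NormedAddCommGroup E] [NormedSpace ℝ E] {A : Set Ω}
    (hA : MeasurableSet A) (g : ι → Ω → E) :
    Q.value (fun i => A.indicator (g i)) = ∑ i ∈ Q.support, ∫ ω in A, Q i ω • g i ω ∂P := by
  refine Finset.sum_congr rfl fun i _ => ?_
  rw [← integral_indicator hA]
  congr 1
  ext1 ω
  by_cases h : ω ∈ A <;> simp [h]

namespace IsRobustPricingSystem

theorem integrable_increment (hQ : IsRobustPricingSystem S Q) (i : ι) (t : Fin T) :
    Integrable (fun ω => Q i ω • (S i t.succ ω - S i t.castSucc ω)) P := by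
  simp only [smul_sub]
  exact (hQ.defined t.succ i).sub (hQ.defined t.castSucc i)

theorem integrableOn_inner (hQ : IsRobustPricingSystem S Q) (i : ι) {t : Fin T}
    {h : Ω → Assets d} (hh : StronglyMeasurable h) {B : Set Ω} (hB : MeasurableSet B) {M : ℝ}
    (hM : ∀ ω ∈ B, ‖h ω‖ ≤ M) :
    IntegrableOn (fun ω => Q i ω * inner ℝ (h ω) (S i t.succ ω - S i t.castSucc ω)) B P := by
  have h1 := (hQ.integrable_increment i t).integrableOn (s := B)
  have h2 := (innerSL ℝ (E := Assets d)).integrable_of_bilin_of_bdd_left M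
    (μ := P.restrict B) hh.aestronglyMeasurable
    (by filter_upwards [ae_restrict_mem hB] with ω hω using hM ω hω) h1
  exact h2.congr (ae_of_all _ fun ω =>
    (innerSL ℝ (h ω)).map_smul (Q i ω) (S i t.succ ω - S i t.castSucc ω))

theorem setIntegral_increment (hQ : IsRobustPricingSystem S Q) (t : Fin T) {A : Set Ω}
    (hA : MeasurableSet[ℱ t.castSucc] A) :
    ∫ ω in A, ∑ i ∈ Q.support, Q i ω • (S i t.succ ω - S i t.castSucc ω) ∂P = 0 := by
  have hA' := ℱ.le _ A hA
  have h := hQ.martingale t A hA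
  rw [value_indicator hA', value_indicator hA', ← sub_eq_zero, ← Finset.sum_sub_distrib] at h
  rw [integral_finsetSum _ fun i _ => (hQ.integrable_increment i t).integrableOn, ← h]
  refine Finset.sum_congr rfl fun i _ => ?_
  simp only [smul_sub]
  exact integral_sub (hQ.defined t.succ i).integrableOn (hQ.defined t.castSucc i).integrableOn

/-- Bounded positions held over one period have price zero. -/
theorem sum_setIntegral_inner (hQ : IsRobustPricingSystem S Q) [IsFiniteMeasure P] {t : Fin T}
    {h : Ω → Assets d} (hh : StronglyMeasurable[ℱ t.castSucc] h) {B : Set Ω}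
    (hB : MeasurableSet[ℱ t.castSucc] B) {M : ℝ} (hM : ∀ ω ∈ B, ‖h ω‖ ≤ M) :
    ∑ i ∈ Q.support, ∫ ω in B,
      Q i ω * inner ℝ (h ω) (S i t.succ ω - S i t.castSucc ω) ∂P = 0 := by
  classical
  have hm := ℱ.le t.castSucc
  have hB' := hm B hB
  set D : Ω → Assets d := fun ω => ∑ i ∈ Q.support, Q i ω • (S i t.succ ω - S i t.castSucc ω)
    with hD
  have hDi : Integrable D P := integrable_finsetSum _ fun i _ => hQ.integrable_increment i t
  -- Only the sum over the models has zero conditional expectation; that suffices because `h` is the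
  -- same in all models.
  have hcond : (0 : Ω → Assets d) =ᵐ[P] P[D | ℱ t.castSucc] := by
    refine ae_eq_condExp_of_forall_setIntegral_eq hm hDi (fun A _ _ => integrableOn_zero)
      (fun A hA _ => ?_) aestronglyMeasurable_zero
    rw [hQ.setIntegral_increment t hA]
    simp
  have hhB : StronglyMeasurable[ℱ t.castSucc] (B.indicator h) := hh.indicator hB
  have hint : Integrable (fun ω => innerSL ℝ (B.indicator h ω) (D ω)) P :=
    (innerSL ℝ (E := Assets d)).integrable_of_bilin_of_bdd_left (max M 0)
      (hhB.mono hm).aestronglyMeasurable (ae_of_all _ fun ω => by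
        by_cases hω : ω ∈ B
        · simpa [hω] using Or.inl (hM ω hω)
        · simp [hω]) hDi
  have hpull := condExp_bilin_of_stronglyMeasurable_left (innerSL ℝ (E := Assets d)) hhB hint hDi
  have hzero : ∫ ω, innerSL ℝ (B.indicator h ω) (D ω) ∂P = 0 := by
    rw [← integral_condExp hm]
    refine integral_eq_zero_of_ae ?_
    filter_upwards [hpull, hcond] with ω h1 h2
    rw [h1, ← h2]
    simp
  rw [← integral_finsetSum _ fun i _ => hQ.integrableOn_inner i (hh.mono hm) hB' hM, ← hzero,
    ← integral_indicator hB']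
  congr 1
  ext1 ω
  by_cases hω : ω ∈ B
  · simp [hω, hD]
  · simp [hω]

end IsRobustPricingSystem

/-- The gain up to date `k`. -/
def gainUpTo (S : Fin (T + 1) → Ω → Assets d) (H : Fin T → Ω → Assets d) (k : ℕ) (ω : Ω) : ℝ :=
  ∑ t : Fin T with t.val < k, inner ℝ (H t ω) (S t.succ ω - S t.castSucc ω)

theorem gainUpTo_zero (S : Fin (T + 1) → Ω → Assets d) (H : Fin T → Ω → Assets d) (ω : Ω) :
    gainUpTo S H 0 ω = 0 := by
  simp [gainUpTo]

theorem gainUpTo_last (S : Fin (T + 1) → Ω → Assets d) (H : Fin T → Ω → Assets d) (ω : Ω) :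
    gainUpTo S H T ω = gain S H ω := by
  simp [gainUpTo, gain]

theorem gainUpTo_succ (S : Fin (T + 1) → Ω → Assets d) (H : Fin T → Ω → Assets d) (t : Fin T)
    (ω : Ω) : gainUpTo S H (t.val + 1) ω =
      gainUpTo S H t.val ω + inner ℝ (H t ω) (S t.succ ω - S t.castSucc ω) := by
  classical
  have : (Finset.univ.filter fun s : Fin T => s.val < t.val + 1) =
      insert t (Finset.univ.filter fun s : Fin T => s.val < t.val) := by
    ext s
    simp only [Finset.mem_filter, Finset.mem_univ, true_and, Finset.mem_insert, Fin.ext_iff]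
    omega
  rw [gainUpTo, this, Finset.sum_insert (by simp), add_comm]
  rfl

namespace IsRobustPricingSystem

theorem integrable_weight [IsFiniteMeasure P] (Q : Functionals ι P ℱ) (i : ι) :
    Integrable (fun ω => Q i ω) P :=
  integrable_of_integrable_trim (ℱ.le (Fin.last T)) ((Lp.memLp (Q i)).integrable le_top)

theorem integrableOn_gainUpTo [IsFiniteMeasure P] (hQ : IsRobustPricingSystem S Q)
    {H : Fin T → Ω → Assets d} (hH : IsStrategy ℱ H) (x : ℝ) (k : ℕ) {B : Set Ω}
    (hB : MeasurableSet B) {M : ℝ} (hM : ∀ t : Fin T, t.val < k → ∀ ω ∈ B, ‖H t ω‖ ≤ M) (i : ι) :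
    IntegrableOn (fun ω => Q i ω * (x + gainUpTo (S i) H k ω)) B P := by
  simp only [gainUpTo, mul_add, Finset.mul_sum]
  refine ((integrable_weight Q i).mul_const x).integrableOn.add
    (integrable_finsetSum _ fun t ht => ?_)
  exact hQ.integrableOn_inner i ((hH t).mono (ℱ.le _)) hB (hM t (Finset.mem_filter.1 ht).2)

/-- Backward induction over dates. Working on events `B` where the earlier positions are bounded
keeps the right-hand side integrable. -/
theorem sum_setIntegral_gain [IsFiniteMeasure P] (hQ : IsRobustPricingSystem S Q)
    {H : Fin T → Ω → Assets d} (hH : IsStrategy ℱ H) {x : ℝ}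
    (hnn : ∀ i, ∀ᵐ ω ∂P, 0 ≤ x + gainUpTo (S i) H T ω) (t : Fin (T + 1)) :
    ∀ B, MeasurableSet[ℱ t] B →
      (∃ M, ∀ s : Fin T, s.val < t.val → ∀ ω ∈ B, ‖H s ω‖ ≤ M) →
      (∀ i ∈ Q.support, IntegrableOn (fun ω => Q i ω * (x + gainUpTo (S i) H T ω)) B P) ∧
        ∑ i ∈ Q.support, ∫ ω in B, Q i ω * (x + gainUpTo (S i) H T ω) ∂P =
          ∑ i ∈ Q.support, ∫ ω in B, Q i ω * (x + gainUpTo (S i) H t.val ω) ∂P := by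
  induction t using Fin.reverseInduction with
  | last =>
    rintro B hB ⟨M, hM⟩
    exact ⟨fun i _ => hQ.integrableOn_gainUpTo hH x T (ℱ.le _ B hB) hM i, rfl⟩
  | cast t ih =>
    rintro B hB ⟨M, hM⟩
    have hB' := ℱ.le _ B hB
    -- On `A n ∩ B` the position at `t` is bounded too, so the induction hypothesis applies and the
    -- gain of period `t` has price zero.
    set A : ℕ → Set Ω := fun n => {ω | ‖H t ω‖ ≤ n} with hAdef
    have hA : ∀ n, MeasurableSet[ℱ t.castSucc] (A n) := fun n =>
      (hH t).norm.measurableSet_le stronglyMeasurable_const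
    have hcov : AECover (P.restrict B) atTop A :=
      ⟨ae_of_all _ fun ω => by
        obtain ⟨n, hn⟩ := exists_nat_ge ‖H t ω‖
        filter_upwards [eventually_ge_atTop n] with k hk
        exact hn.trans (by exact_mod_cast hk), fun n => ℱ.le _ _ (hA n)⟩
    have hres : ∀ n, (P.restrict B).restrict (A n) = P.restrict (A n ∩ B) := fun n =>
      Measure.restrict_restrict (ℱ.le _ _ (hA n))
    have hAB : ∀ n, MeasurableSet[ℱ t.castSucc] (A n ∩ B) := fun n => (hA n).inter hB
    have hbd : ∀ n, ∃ M, ∀ s : Fin T, s.val < t.succ.val → ∀ ω ∈ A n ∩ B, ‖H s ω‖ ≤ M := by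
      intro n
      refine ⟨max M n, fun s hs ω hω => ?_⟩
      by_cases hst : s = t
      · subst hst
        exact le_max_of_le_right hω.1
      · have : s.val ≠ t.val := fun h => hst (Fin.ext h)
        rw [Fin.val_succ] at hs
        exact le_max_of_le_left (hM s (by simp; omega) ω hω.2)
    have hih := fun n => ih (A n ∩ B) (ℱ.mono (Fin.castSucc_le_succ t) _ (hAB n)) (hbd n)
    have hintB : ∀ i, IntegrableOn (fun ω => Q i ω * (x + gainUpTo (S i) H t.val ω)) B P :=
      fun i => hQ.integrableOn_gainUpTo hH x t.val hB' hM i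
    have hstep : ∀ n, ∑ i ∈ Q.support, ∫ ω in A n ∩ B, Q i ω * (x + gainUpTo (S i) H T ω) ∂P =
        ∑ i ∈ Q.support, ∫ ω in A n ∩ B, Q i ω * (x + gainUpTo (S i) H t.val ω) ∂P := by
      intro n
      rw [(hih n).2, ← sub_eq_zero, ← Finset.sum_sub_distrib,
        ← hQ.sum_setIntegral_inner (hH t) (hAB n) (M := n) fun ω hω => hω.1]
      refine Finset.sum_congr rfl fun i _ => ?_
      obtain ⟨M', hM'⟩ := hbd n
      rw [← integral_sub (hQ.integrableOn_gainUpTo hH x t.succ.val (ℱ.le _ _ (hAB n)) hM' i)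
        ((hintB i).mono_set Set.inter_subset_right)]
      refine integral_congr_ae (ae_of_all _ fun ω => ?_)
      simp only [Fin.val_succ, gainUpTo_succ]
      ring
    have hlim : Tendsto (fun n => ∑ i ∈ Q.support,
        ∫ ω in A n ∩ B, Q i ω * (x + gainUpTo (S i) H t.val ω) ∂P) atTop
        (𝓝 (∑ i ∈ Q.support, ∫ ω in B, Q i ω * (x + gainUpTo (S i) H t.val ω) ∂P)) := by
      refine tendsto_finsetSum _ fun i _ => ?_
      have := hcov.integral_tendsto_of_countably_generated (hintB i)
      simpa only [hres] using this
    have hnnQ : ∀ i, ∀ᵐ ω ∂P, 0 ≤ Q i ω * (x + gainUpTo (S i) H T ω) := fun i => by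
      filter_upwards [hQ.nonneg i, hnn i] with ω h1 h2
      exact mul_nonneg h1 h2
    obtain ⟨I, hI⟩ := hlim.bddAbove_range
    -- By nonnegativity each model's integral over `A n ∩ B` is at most the sum over all models,
    -- which converges and so is bounded in `n`.
    have hint : ∀ i ∈ Q.support,
        IntegrableOn (fun ω => Q i ω * (x + gainUpTo (S i) H T ω)) B P := by
      intro i hi
      refine hcov.integrable_of_integral_bounded_of_nonneg_ae I (fun n => ?_)
        (ae_restrict_of_ae (hnnQ i)) (Eventually.of_forall fun n => ?_)
      · rw [IntegrableOn, hres]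
        exact (hih n).1 i hi
      · rw [hres]
        refine le_trans ?_ (hI ⟨n, rfl⟩)
        simp only
        rw [← hstep n]
        exact Finset.single_le_sum (f := fun i => ∫ ω in A n ∩ B,
          Q i ω * (x + gainUpTo (S i) H T ω) ∂P)
          (fun i _ => integral_nonneg_of_ae (ae_restrict_of_ae (hnnQ i))) hi
    refine ⟨hint, ?_⟩
    have hlim' : Tendsto (fun n => ∑ i ∈ Q.support,
        ∫ ω in A n ∩ B, Q i ω * (x + gainUpTo (S i) H T ω) ∂P) atTop
        (𝓝 (∑ i ∈ Q.support, ∫ ω in B, Q i ω * (x + gainUpTo (S i) H T ω) ∂P)) := by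
      refine tendsto_finsetSum _ fun i hi => ?_
      have := hcov.integral_tendsto_of_countably_generated (hint i hi)
      simpa only [hres] using this
    simp only [hstep] at hlim'
    exact tendsto_nhds_unique hlim' hlim

/-- A nonnegative claim that is replicable from the initial capital `x` has price `x`. -/
theorem value_eq_of_replicated [IsFiniteMeasure P] (hQ : IsRobustPricingSystem S Q)
    {H : Fin T → Ω → Assets d} (hH : IsStrategy ℱ H) {x : ℝ} {f : ι → Ω → ℝ}
    (hf : ∀ i, ∀ᵐ ω ∂P, 0 ≤ f i ω) (hx : ∀ i, ∀ᵐ ω ∂P, x + gain (S i) H ω = f i ω) :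
    Q.Defined f ∧ Q.value f = x := by
  have hnn : ∀ i, ∀ᵐ ω ∂P, 0 ≤ x + gainUpTo (S i) H T ω := fun i => by
    filter_upwards [hf i, hx i] with ω h1 h2
    rwa [gainUpTo_last, h2]
  -- At date zero there are no earlier positions to bound, so the whole space is admissible.
  obtain ⟨hint, hsum⟩ := hQ.sum_setIntegral_gain hH hnn 0 Set.univ MeasurableSet.univ
    ⟨0, fun s hs => by simp at hs⟩
  have hae : ∀ i, (fun ω => Q i ω * (x + gainUpTo (S i) H T ω)) =ᵐ[P]
      fun ω => Q i ω • f i ω := fun i => by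
    filter_upwards [hx i] with ω hω
    rw [gainUpTo_last, hω, smul_eq_mul]
  refine ⟨fun i => ?_, ?_⟩
  · by_cases hi : i ∈ Q.support
    · exact (integrableOn_univ.1 (hint i hi)).congr (hae i)
    · refine (integrable_zero Ω ℝ P).congr ?_
      filter_upwards [Functionals.ae_eq_zero hi] with ω hω
      simp [hω]
  · have h1 := hQ.normalized
    simp only [Functionals.value, smul_eq_mul, mul_one] at h1
    simp only [Measure.restrict_univ, Fin.val_zero, gainUpTo_zero, add_zero,
      integral_mul_const] at hsum
    rw [← Finset.sum_mul, h1, one_mul] at hsum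
    rw [← hsum]
    exact Finset.sum_congr rfl fun i _ => integral_congr_ae (hae i).symm

end IsRobustPricingSystem

end Replicable

/-! ### Claims with a constant price are replicable -/

section ConstantPrice

variable {Ω : Type*} {mΩ : MeasurableSpace Ω} {P : Measure Ω} {T d : ℕ}
  {ℱ : Filtration (Fin (T + 1)) mΩ} {Θ : Type*} {S : Θ → Fin (T + 1) → Ω → Assets d}

/-- For a fixed strategy the gain is continuous in the prices, so the sign passes to a.s. limits
along the subsequence. -/
theorem gain_nonneg_of_dense [TopologicalSpace Θ] [FrechetUrysohnSpace Θ]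
    (hcont : IsContinuousFamily P S) {D : Set Θ} (hD : Dense D) {H : Fin T → Ω → Assets d}
    (h : ∀ θ ∈ D, ∀ᵐ ω ∂P, 0 ≤ gain (S θ) H ω) (θ : Θ) : ∀ᵐ ω ∂P, 0 ≤ gain (S θ) H ω := by
  obtain ⟨u, hu, hlim⟩ := mem_closure_iff_seq_limit.1 (hD θ)
  obtain ⟨φ, -, hφ⟩ := hcont u θ hlim
  filter_upwards [ae_all_iff.2 hφ, ae_all_iff.2 fun n => h (u n) (hu n)] with ω h1 h2
  have h3 : Tendsto (fun k => gain (S (u (φ k))) H ω) atTop (𝓝 (gain (S θ) H ω)) :=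
    tendsto_finsetSum _ fun t _ => tendsto_const_nhds.inner ((h1 t.succ).sub (h1 t.castSucc))
  exact ge_of_tendsto' h3 fun k => h2 (φ k)

theorem Functionals.value_embDomain {E : Type*} [NormedAddCommGroup E] [NormedSpace ℝ E]
    {D : Set Θ} (Q : Functionals D P ℱ) (g : Θ → Ω → E) :
    Functionals.value (Finsupp.embDomain (Function.Embedding.subtype (· ∈ D)) Q :
      Functionals Θ P ℱ) g = Q.value fun θ => g θ := by
  simp only [Functionals.value, Finsupp.support_embDomain, Finset.sum_map,
    Finsupp.embDomain_apply_self]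
  rfl

theorem Functionals.ae_embDomain {D : Set Θ} (Q : Functionals D P ℱ) (θ : Θ) :
    (∃ θ' : D, θ' = θ ∧ (Finsupp.embDomain (Function.Embedding.subtype (· ∈ D)) Q :
      Functionals Θ P ℱ) θ = Q θ') ∨
    (θ ∉ D ∧ ∀ᵐ ω ∂P, (Finsupp.embDomain (Function.Embedding.subtype (· ∈ D)) Q :
      Functionals Θ P ℱ) θ ω = 0) := by
  by_cases hθ : θ ∈ D
  · exact Or.inl ⟨⟨θ, hθ⟩, rfl,
      Finsupp.embDomain_apply_self (Function.Embedding.subtype (· ∈ D)) Q ⟨θ, hθ⟩⟩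
  · refine Or.inr ⟨hθ, Functionals.ae_eq_zero ?_⟩
    simp [hθ]

/-- A robust pricing system for a subfamily of models is one for the whole family. -/
theorem IsRobustPricingSystem.embDomain {D : Set Θ} {Q : Functionals D P ℱ}
    (hQ : IsRobustPricingSystem (fun θ : D => S θ) Q) :
    IsRobustPricingSystem S
      (Finsupp.embDomain (Function.Embedding.subtype (· ∈ D)) Q : Functionals Θ P ℱ) where
  nonneg θ := by
    rcases Functionals.ae_embDomain Q θ with ⟨θ', -, h⟩ | ⟨-, h⟩
    · rw [h]; exact hQ.nonneg θ'
    · filter_upwards [h] with ω hω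
      rw [hω]
  pos := by
    obtain ⟨θ, A, hA, hpos⟩ := hQ.pos
    refine ⟨θ, A, hA, ?_⟩
    rwa [show ((θ : Θ)) = Function.Embedding.subtype (· ∈ D) θ from rfl,
      Finsupp.embDomain_apply_self]
  normalized := by
    rw [Functionals.value_embDomain]; exact hQ.normalized
  defined t θ := by
    rcases Functionals.ae_embDomain Q θ with ⟨θ', rfl, h⟩ | ⟨-, h⟩
    · simp only [h]; exact hQ.defined t θ'
    · refine (integrable_zero Ω (Assets d) P).congr ?_
      filter_upwards [h] with ω hω
      rw [hω, zero_smul]; rfl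
  martingale t A hA := by
    rw [Functionals.value_embDomain, Functionals.value_embDomain]; exact hQ.martingale t A hA

theorem IsRobustPricingSystem.mem_pricingSystems {Q : Functionals Θ P ℱ}
    (hQ : IsRobustPricingSystem S Q) : Q ∈ pricingSystems P ℱ S := by
  obtain ⟨θ, A, -, hpos⟩ := hQ.pos
  refine Set.mem_iUnion.2 ⟨θ, hQ, fun h0 => ?_⟩
  have hae : ∀ᵐ ω ∂P, Q θ ω = 0 := Functionals.ae_eq_zero (by simpa using h0)
  rw [integral_eq_zero_of_ae (ae_restrict_of_ae hae)] at hpos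
  exact lt_irrefl _ hpos

theorem mem_pricingSystems_iff {Q : Functionals Θ P ℱ} :
    Q ∈ pricingSystems P ℱ S ↔ IsRobustPricingSystem S Q :=
  ⟨fun h => by obtain ⟨θ, hQ, -⟩ := Set.mem_iUnion.1 h; exact hQ, fun h => h.mem_pricingSystems⟩

/-- On a countable dense family of models, a claim with a constant price is replicable. -/
theorem exists_replicating_on_countable_dense [TopologicalSpace Θ] [FrechetUrysohnSpace Θ]
    [IsProbabilityMeasure P] (hS : ∀ θ t, StronglyMeasurable[ℱ t] (S θ t))
    (hcont : IsContinuousFamily P S) (hNRA : NRA P ℱ S) {f : Θ → Ω → ℝ}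
    (hf : ∀ θ, StronglyMeasurable[ℱ (Fin.last T)] (f θ)) {c : ℝ}
    (hc : ∀ Q ∈ pricingSystems P ℱ S, Q.Defined f ∧ Q.value f = c) {D : Set Θ}
    (hDc : D.Countable) (hD : Dense D) :
    ∃ H : Fin T → Ω → Assets d, IsStrategy ℱ H ∧
      ∀ θ ∈ D, ∀ᵐ ω ∂P, c + gain (S θ) H ω = f θ ω := by
  have := hDc.to_subtype
  have hNRA' : NRA P ℱ fun θ : D => S θ := fun H hH h θ =>
    hNRA H hH (gain_nonneg_of_dense hcont hD fun θ hθ => h ⟨θ, hθ⟩) θ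
  have hprice : ∀ Q : Functionals D P ℱ, IsRobustPricingSystem (fun θ : D => S θ) Q →
      ∀ a : ℝ, Q.value (fun θ ω => a * (f θ ω - c)) = 0 := by
    intro Q hQ a
    obtain ⟨hdef, hval⟩ := hc _ hQ.embDomain.mem_pricingSystems
    rw [Functionals.value_embDomain] at hval
    have hdef' : Q.Defined fun θ : D => f θ := fun θ => by
      have h := hdef (Function.Embedding.subtype (· ∈ D) θ)
      rw [Finsupp.embDomain_apply_self] at h
      exact h
    have hdc : Q.Defined fun (_ : D) (_ : Ω) => c := fun θ =>
      (IsRobustPricingSystem.integrable_weight Q θ).mul_const c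
    have h1 := Functionals.value_sub hdef' hdc
    have h2 : Q.value (fun (_ : D) (_ : Ω) => c) = c := by
      have := hQ.normalized
      simp only [Functionals.value, smul_eq_mul, mul_one] at this
      simp only [Functionals.value, smul_eq_mul, integral_mul_const]
      rw [← Finset.sum_mul, this, one_mul]
    rw [hval, h2, sub_self] at h1
    have h3 : Q.value (fun θ ω => a * (f θ ω - c)) = a * Q.value fun θ ω => f θ ω - c := by
      simp only [Functionals.value, Finset.mul_sum, ← integral_const_mul, smul_eq_mul]
      simp only [mul_left_comm]
    rw [h3, h1, mul_zero]
  have hmem : ∀ a : ℝ, (fun (θ : D) ω => a * (f θ ω - c)) ∈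
      superhedged P ℱ fun θ : D => S θ := by
    intro a
    by_contra hnot
    obtain ⟨Q, hQ, -, hpos⟩ := exists_isRobustPricingSystem_value_pos (S := fun θ : D => S θ)
      (g := fun (θ : D) ω => a * (f θ ω - c)) (fun θ => hS θ) hNRA'
      (fun θ => stronglyMeasurable_const.mul ((hf θ).sub stronglyMeasurable_const)) hnot
    rw [hprice Q hQ a] at hpos
    exact lt_irrefl _ hpos
  -- `H` dominates `f - c` and `H'` dominates `c - f`; their sum has nonnegative gain, hence zero
  -- gain, which forces equality in both.
  obtain ⟨H, hH, h1⟩ := hmem 1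
  obtain ⟨H', hH', h2⟩ := hmem (-1)
  have h0 := hNRA' _ (hH.add hH') fun θ => by
    filter_upwards [h1 θ, h2 θ] with ω e1 e2
    rw [gain_add]
    linarith
  refine ⟨H, hH, fun θ hθ => ?_⟩
  filter_upwards [h0 ⟨θ, hθ⟩, h1 ⟨θ, hθ⟩, h2 ⟨θ, hθ⟩] with ω e0 e1 e2
  rw [gain_add] at e0
  linarith

theorem isReplicable_of_hasConstantPrice [TopologicalSpace Θ] [FrechetUrysohnSpace Θ]
    [TopologicalSpace.SeparableSpace Θ] [IsProbabilityMeasure P]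
    (hS : ∀ θ t, StronglyMeasurable[ℱ t] (S θ t)) (hcont : IsContinuousFamily P S)
    (hNRA : NRA P ℱ S) {f : Θ → Ω → ℝ}
    (hf : ∀ θ, StronglyMeasurable[ℱ (Fin.last T)] (f θ)) (hc : HasConstantPrice P ℱ S f) :
    IsReplicable P ℱ S f := by
  obtain ⟨c, hc⟩ := hc
  obtain ⟨D, hDc, hD⟩ := TopologicalSpace.exists_countable_dense Θ
  obtain ⟨H, hH, hrep⟩ := exists_replicating_on_countable_dense hS hcont hNRA hf hc hDc hD
  refine ⟨c, H, hH, fun θ => ?_⟩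
  -- `H'` depends on `θ`, but it agrees in gain with `H` on `D`, and NRA carries this agreement over
  -- to `θ`.
  obtain ⟨H', hH', hrep'⟩ := exists_replicating_on_countable_dense hS hcont hNRA hf hc
    (hDc.insert θ) (hD.mono (Set.subset_insert θ D))
  have hdiff : ∀ θ' ∈ D, ∀ᵐ ω ∂P, 0 ≤ gain (S θ') (fun t ω => H t ω + -H' t ω) ω := by
    intro θ' hθ'
    filter_upwards [hrep θ' hθ', hrep' θ' (Set.mem_insert_of_mem θ hθ')] with ω e1 e2
    rw [gain_add, gain_neg]
    linarith
  filter_upwards [hNRA _ (hH.add hH'.neg) (gain_nonneg_of_dense hcont hD hdiff) θ,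
    hrep' θ (Set.mem_insert θ D)] with ω e1 e2
  rw [gain_add, gain_neg] at e1
  linarith

theorem hasConstantPrice_of_isReplicable [IsProbabilityMeasure P] {f : Θ → Ω → ℝ}
    (hf : ∀ θ, ∀ᵐ ω ∂P, 0 ≤ f θ ω) (h : IsReplicable P ℱ S f) : HasConstantPrice P ℱ S f := by
  obtain ⟨x, H, hH, hx⟩ := h
  exact ⟨x, fun Q hQ => (mem_pricingSystems_iff.1 hQ).value_eq_of_replicated hH hf hx⟩

end ConstantPrice

end

end RobustMarket

theorem mainTheorem6 {Ω : Type*} {mΩ : MeasurableSpace Ω} (P : Measure Ω) [IsProbabilityMeasure P]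
    (T d : ℕ) (hd : 1 ≤ d)
    (ℱ : Filtration (Fin (T + 1)) mΩ)
    (hℱ : ∀ A : Set Ω, MeasurableSet A → P A = 0 → MeasurableSet[ℱ 0] A)
    {X : Type*} [MetricSpace X] [TopologicalSpace.SeparableSpace X]
    (Θ : Set X) (hΘ : IsClosed Θ) (hne : Θ.Nonempty)
    (S : Θ → Fin (T + 1) → Ω → RobustMarket.Assets d)
    (hS : ∀ θ t, StronglyMeasurable[ℱ t] (S θ t))
    (hS0 : ∀ θ, ∀ᵐ ω ∂P, ∀ i, S θ 0 ω i = 1)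
    (hcont : RobustMarket.IsContinuousFamily P S)
    (hNRA : RobustMarket.NRA P ℱ S)
    (f : Θ → Ω → ℝ) (hf : RobustMarket.IsContingentClaim P ℱ f) :
    RobustMarket.IsReplicable P ℱ S f ↔ RobustMarket.HasConstantPrice P ℱ S f := by
  exact ⟨RobustMarket.hasConstantPrice_of_isReplicable fun θ => (hf θ).2,
    RobustMarket.isReplicable_of_hasConstantPrice hS hcont hNRA fun θ => (hf θ).1⟩
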